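/- **Theorem 4 (Random design, weakly piecewise polynomial).** Fix an integer $k\ge 0$, exponents $q_1,q_2\in(0,1)$ and constants $\sigma_x>0$ and $c,c'>0$. A random variable $Y$ is called $\sigma$-sub-Gaussian if $\mathbb E Y=0$ and $\mathbb E e^{tY}\le e^{\sigma^2t^2/2}$ for all $t\in\mathbb R$; a random vector $Y$ is $\sigma$-sub-Gaussian if $\mathbb E Y=0$ and $u^TY$ is $\sigma$-sub-Gaussian for every Euclidean unit vector $u$. Let $\mathcal G$ be a graph on $n$ nodes with maximum degree $d$. Let $F$ be its oriented incidence matrix (the row of the edge $(i,j)$, $i<j$, has $-1$ in entry $i$, $+1$ in entry $j$, and $0$ elsewhere), $L=F^TF$ its Laplacian, and let $\Delta^{(k+1)}=FL^{k/2}$ for even $k$ and $\Delta^{(k+1)}=L^{(k+1)/2}$ for odd $k$. For $R_1,R_2>0$ put $$\mathcal S(k,q_1,q_2,R_1,R_2)=\Big\{\beta\in\mathbb R^n:\ \sum_i\big|(\Delta^{(k+1)}\beta)_i\big|^{q_1}\le R_1,\ \ \sum_j|\beta_j|^{q_2}\le R_2\Big\}.$$ Consider the linear model $y=X\beta^*+\varepsilon$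 with $\beta^*\in\mathcal S(k,q_1,q_2,R_1,R_2)$, where the rows of $X\in\mathbb R^{N\times n}$ are i.i.d. $\sigma_x$-sub-Gaussian vectors with covariance matrix $\Sigma_x$ all of whose eigenvalues lie in $[c,c']$, the components of $\varepsilon\in\mathbb R^N$ are i.i.d. $\sigma_\varepsilon$-sub-Gaussian, and $\varepsilon$ is independent of $X$. For $\lambda,\lambda_g\ge0$ let $\hat\beta$ be any minimizer over $\beta\in\mathbb R^n$ of $$\frac1{2N}\|y-X\beta\|_2^2+\lambda_g\|\Delta^{(k+1)}\beta\|_1+\lambda\|\beta\|_1 .$$ Then there is a constant $C_0>0$, depending only on $\sigma_x,c,c'$, with the following property. Consider a sequence of such models in which $N\to\infty$ and $n\to\infty$, while $\mathcal G$, $\beta^*$, $R_1$, $R_2$, $\Sigma_x$, $\sigma_\varepsilon$ and the distributions may vary along the sequence; $\sigma_\varepsilon$ is a positive constant or, more generally, is bounded below by a positive constant. Assume that, for some constants $C_1$ and $K$, all along the sequence $$C_0\,\sigma_\varepsilon\sqrt{\tfrac{\log n}{N}}\le\lambda\le C_1\,\sigma_\varepsilon\sqrt{\tfrac{\log n}{N}},\qquad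 \lambda_g=2^{-(1+k/2)}d^{-(k+1)/2}\lambda,$$ $$R_1\Big(\tfrac{\log n}{N}\Big)^{1-\frac{q_1}2}+R_2\Big(\tfrac{\log n}{N}\Big)^{1-\frac{q_2}2}\le K$$ (if $d=0$, then $\Delta^{(k+1)}\beta=0$ for all $\beta$ and the value of $\lambda_g$ is immaterial). Then: (a) both $\|\hat\beta-\beta^*\|_2^2$ and $\frac1N\|X(\hat\beta-\beta^*)\|_2^2$ are $$\mathcal O_{\mathbb P}\Big(\sigma_\varepsilon^2\Big(R_1\Big(\tfrac{\log n}{N}\Big)^{1-\frac{q_1}2}+R_2\Big(\tfrac{\log n}{N}\Big)^{1-\frac{q_2}2}\Big)\Big);$$ (b) $\displaystyle \|\hat\beta-\beta^*\|_1^2=\mathcal O_{\mathbb P}\Big(\sigma_\varepsilon^2\Big(R_1^2\Big(\tfrac{\log n}{N}\Big)^{1-q_1}+R_2^2\Big(\tfrac{\log n}{N}\Big)^{1-q_2}\Big)\Big).$ Here $Y=\mathcal O_{\mathbb P}(a)$ means: for every $\delta>0$ there is $M>0$ such that $\mathbb P(|Y|>Ma)\le\delta$ for all models far enough along the sequence.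 -/

import Mathlib

open MeasureTheory ProbabilityTheory Filter

noncomputable section

namespace GraphLasso

/-! ### Graph difference operators -/

/-- The edges `(i, j)` with `i < j` of an undirected graph on the nodes `0, …, n - 1`. -/
abbrev Edge {n : ℕ} (G : SimpleGraph (Fin n)) : Type :=
  {e : Fin n × Fin n // e.1 < e.2 ∧ G.Adj e.1 e.2}

instance instFintypeEdge {n : ℕ} (G : SimpleGraph (Fin n)) : Fintype (Edge G) :=
  Fintype.ofFinite _

/-- The oriented incidence matrix `F`: the row of the edge `(i, j)`, `i < j`, has `-1` in
entry `i`, `+1` in entry `j` and `0` elsewhere. -/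
def incidence {n : ℕ} (G : SimpleGraph (Fin n)) : Matrix (Edge G) (Fin n) ℝ :=
  fun e v => if v = e.1.1 then -1 else if v = e.1.2 then 1 else 0

/-- The graph Laplacian `L = Fᵀ F`. -/
def laplacian {n : ℕ} (G : SimpleGraph (Fin n)) : Matrix (Fin n) (Fin n) ℝ :=
  (incidence G).transpose * incidence G

/-- Row index of a graph difference operator: edges (`false`) or nodes (`true`). -/
def DiffRow {n : ℕ} (G : SimpleGraph (Fin n)) : Bool → Type
  | false => Edge G
  | true => Fin n

instance instFintypeDiffRow {n : ℕ} (G : SimpleGraph (Fin n)) :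
    (b : Bool) → Fintype (DiffRow G b)
  | false => instFintypeEdge G
  | true => Fin.fintype n

/-- `F L^(k/2)` (edge rows) and `L^((k+1)/2)` (node rows). -/
def diffAux {n : ℕ} (G : SimpleGraph (Fin n)) (k : ℕ) :
    (b : Bool) → Matrix (DiffRow G b) (Fin n) ℝ
  | false => (incidence G * laplacian G ^ (k / 2) : Matrix (Edge G) (Fin n) ℝ)
  | true => (laplacian G ^ ((k + 1) / 2) : Matrix (Fin n) (Fin n) ℝ)

/-- The graph difference operator `Δ^(k+1)` of order `k + 1`: it is `F L^(k/2)` for even `k` and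
`L^((k+1)/2)` for odd `k` (`k.bodd` is `true` exactly when `k` is odd). -/
def graphDiff {n : ℕ} (G : SimpleGraph (Fin n)) (k : ℕ) :
    Matrix (DiffRow G k.bodd) (Fin n) ℝ :=
  diffAux G k k.bodd

open Classical in
/-- The maximum degree of the graph. -/
def maxDeg {n : ℕ} (G : SimpleGraph (Fin n)) : ℕ := G.maxDegree

/-- The parameter space `S(k, q₁, q₂, R₁, R₂)` of coefficient vectors that are simultaneously
`(k, q₁, R₁)`-weakly piecewise polynomial and `(q₂, R₂)`-weakly sparse. -/
def weakSpace {n : ℕ} (G : SimpleGraph (Fin n)) (k : ℕ) (q₁ q₂ R₁ R₂ : ℝ) :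
    Set (Fin n → ℝ) :=
  {β | ∑ i, |(graphDiff G k).mulVec β i| ^ q₁ ≤ R₁ ∧ ∑ j, |β j| ^ q₂ ≤ R₂}

/-! ### The estimator -/

/-- The objective function
`(2N)⁻¹ ‖y - Xβ‖₂² + λ_g ‖Δ^(k+1) β‖₁ + λ ‖β‖₁`. -/
def objective {N n : ℕ} (G : SimpleGraph (Fin n)) (k : ℕ) (lamg lam : ℝ)
    (X : Matrix (Fin N) (Fin n) ℝ) (y : Fin N → ℝ) (β : Fin n → ℝ) : ℝ :=
  1 / (2 * (N : ℝ)) * ∑ i, (y i - X.mulVec β i) ^ 2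
    + lamg * ∑ i, |(graphDiff G k).mulVec β i| + lam * ∑ j, |β j|

/-- `b` is a `k`-th order Graph-Piecewise-Polynomial-Lasso estimate: a global minimizer of the
objective function. -/
def IsGPPLasso {N n : ℕ} (G : SimpleGraph (Fin n)) (k : ℕ) (lamg lam : ℝ)
    (X : Matrix (Fin N) (Fin n) ℝ) (y : Fin N → ℝ) (b : Fin n → ℝ) : Prop :=
  ∀ β : Fin n → ℝ, objective G k lamg lam X y b ≤ objective G k lamg lam X y β

/-! ### Sub-Gaussian random variables, vectors and matrices -/

/-- A `σ`-sub-Gaussian random variable: mean zero and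
`E[exp (t Y)] ≤ exp (σ² t² / 2)` for all real `t`. -/
def IsSubGaussian {Ω : Type*} [MeasurableSpace Ω] (P : Measure Ω) (Y : Ω → ℝ) (σ : ℝ) : Prop :=
  ∫ ω, Y ω ∂P = 0 ∧ HasSubgaussianMGF Y ⟨σ ^ 2, sq_nonneg σ⟩ P

/-- A `σ`-sub-Gaussian random vector: mean zero, and `uᵀ Y` is `σ`-sub-Gaussian for every
Euclidean unit vector `u`. -/
def IsSubGaussianVec {Ω : Type*} [MeasurableSpace Ω] {n : ℕ} (P : Measure Ω)
    (Y : Ω → Fin n → ℝ) (σ : ℝ) : Prop :=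
  (∀ j, ∫ ω, Y ω j ∂P = 0) ∧
    ∀ u : Fin n → ℝ, ∑ j, u j ^ 2 = 1 → IsSubGaussian P (fun ω => ∑ j, u j * Y ω j) σ

/-- A row-wise `(σ, S)`-sub-Gaussian random matrix: the rows are i.i.d. draws from a
`σ`-sub-Gaussian distribution with covariance matrix `S`. -/
structure IsRowwiseSubGaussian {Ω : Type*} [MeasurableSpace Ω] {N n : ℕ} (P : Measure Ω)
    (X : Ω → Fin N → Fin n → ℝ) (σ : ℝ) (S : Matrix (Fin n) (Fin n) ℝ) : Prop where
  measurable : Measurable X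
  indep : iIndepFun (fun i ω => X ω i) P
  identDistrib : ∀ i i', IdentDistrib (fun ω => X ω i) (fun ω => X ω i') P P
  subGaussian : ∀ i, IsSubGaussianVec P (fun ω => X ω i) σ
  covariance : ∀ i a b, cov[fun ω => X ω i a, fun ω => X ω i b; P] = S a b

/-- A noise vector whose components are i.i.d. draws from a `σ`-sub-Gaussian distribution. -/
structure IsSubGaussianNoise {Ω : Type*} [MeasurableSpace Ω] {N : ℕ} (P : Measure Ω)
    (ε : Ω → Fin N → ℝ) (σ : ℝ) : Prop where
  measurable : Measurable ε
  indep : iIndepFun (fun i ω => ε ω i) P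
  identDistrib : ∀ i i', IdentDistrib (fun ω => ε ω i) (fun ω => ε ω i') P P
  subGaussian : ∀ i, IsSubGaussian P (fun ω => ε ω i) σ

/-! ### Stochastic boundedness -/

/-- `Y t = O_P(a t)` as `t → ∞`, where `Y t` lives on the probability space `(Ω t, P t)`: for every
`δ > 0` there is a constant `M` with `P(|Y t| > M |a t|) ≤ δ` for all large `t`. -/
def IsBigOP {Ω : ℕ → Type*} [∀ t, MeasurableSpace (Ω t)] (P : ∀ t, Measure (Ω t))
    (Y : ∀ t, Ω t → ℝ) (a : ℕ → ℝ) : Prop :=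
  ∀ δ : ℝ, 0 < δ → ∃ M : ℝ, 0 < M ∧
    ∀ᶠ t in atTop, P t {ω | M * |a t| < |Y t ω|} ≤ ENNReal.ofReal δ

end GraphLasso

end

namespace GraphLasso

/-! ### The Euclidean operator norm of the graph difference operators -/

/-! Write v for the estimation error, τ = √(log n / N), ρ = λ_g / λ and r for the sum of the two
rate terms. Comparing the objective at the minimizer and at the truth gives a basic inequality; once
λ/4 dominates the sup norm of Xᵀε/N, the noise costs only a quarter of λ‖v‖₁. Both penalties are
then treated by thresholding at a level η: weak sparsity leaves few entries above η and a small ℓ₁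
tail below it. The choice of λ_g makes ρΔ an ℓ₂ contraction, so the graph penalty on its active rows
is controlled by ‖v‖₂ just like the coordinate penalty (`IsGPPLasso.cone_inequality`).

Two events carry the probability. The noise bound (`IsRowwiseSubGaussian.measure_noise_gt_le`) comes
from fixing ε and using sub-Gaussianity of the columns of X. The restricted eigenvalue bound, with
slack of order τ²‖v‖₁², comes from Maurey's sampling argument: v/‖v‖₁ is an average of signed basis
vectors, so positivity of one quadratic form on the finitely many sums of s such vectors transfers
to all v (`restricted_eigenvalue_of_sparse`). A union bound over these sums replaces nets.

To close the loop, τ²‖v‖₁² must be absorbed into ‖v‖₂². The cone inequality bounds it by a multiple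
of a^(-q) r ‖v‖₂² plus lower terms when η = aτ. Since r is only bounded, not small, the absorption
is achieved by a large constant a, whose price is a larger tail (`error_bounds_of_cone`,
`exists_error_constant`). -/

lemma incidence_mulVec_apply {n : ℕ} (G : SimpleGraph (Fin n)) (v : Fin n → ℝ) (e : Edge G) :
    (incidence G).mulVec v e = v e.1.2 - v e.1.1 := by
  have hne : e.1.2 ≠ e.1.1 := (ne_of_lt e.2.1).symm
  have h : ∀ x, incidence G e x * v x
      = (if x = e.1.2 then v x else 0) - (if x = e.1.1 then v x else 0) := by
    intro x
    unfold incidence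
    by_cases h1 : x = e.1.1
    · subst h1; simp [hne.symm]
    · by_cases h2 : x = e.1.2 <;> simp [h1, h2]
      simp [hne]
  simp only [Matrix.mulVec, dotProduct, h, Finset.sum_sub_distrib, Finset.sum_ite_eq',
    Finset.mem_univ, if_true]

open Classical in
-- Double counting: the weight of a node is counted once for each incident edge, hence as often as
-- its degree.
lemma sum_edge_add_le {n : ℕ} (G : SimpleGraph (Fin n)) (w : Fin n → ℝ) (hw : ∀ i, 0 ≤ w i) :
    ∑ e : Edge G, (w e.1.1 + w e.1.2) ≤ maxDeg G * ∑ i, w i := by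
  have h1 : ∑ e : Edge G, (w e.1.1 + w e.1.2)
      = ∑ e : Fin n × Fin n, if e.1 < e.2 ∧ G.Adj e.1 e.2 then w e.1 + w e.2 else 0 := by
    rw [← Finset.sum_filter]
    exact (Finset.sum_subtype (p := fun e : Fin n × Fin n => e.1 < e.2 ∧ G.Adj e.1 e.2) _
      (by simp) fun e : Fin n × Fin n => w e.1 + w e.2).symm
  have h2 : ∑ e : Fin n × Fin n, (if e.1 < e.2 ∧ G.Adj e.1 e.2 then w e.1 + w e.2 else 0)
      = ∑ i, ∑ j, if G.Adj i j then w i else 0 := by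
    have hs : ∀ i j, (if i < j ∧ G.Adj i j then w i + w j else 0)
        = (if i < j ∧ G.Adj i j then w i else 0) + (if i < j ∧ G.Adj i j then w j else 0) := by
      intro i j; split_ifs <;> simp
    rw [Fintype.sum_prod_type]
    simp only [hs, Finset.sum_add_distrib]
    rw [Finset.sum_comm (f := fun i j => if i < j ∧ G.Adj i j then w j else 0)]
    rw [← Finset.sum_add_distrib]
    refine Finset.sum_congr rfl fun i _ => ?_
    rw [← Finset.sum_add_distrib]
    refine Finset.sum_congr rfl fun j _ => ?_
    by_cases hij : G.Adj i j
    · rcases lt_or_gt_of_ne hij.ne with h | h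
      · simp [h, hij, not_lt.2 h.le]
      · simp [h, hij, hij.symm, not_lt.2 h.le]
    · have : ¬ G.Adj j i := fun h => hij h.symm
      simp [hij, this]
  rw [h1, h2, Finset.mul_sum]
  refine Finset.sum_le_sum fun i _ => ?_
  rw [← Finset.sum_filter, Finset.sum_const, nsmul_eq_mul]
  refine mul_le_mul_of_nonneg_right ?_ (hw i)
  rw [← SimpleGraph.neighborFinset_eq_filter, SimpleGraph.card_neighborFinset_eq_degree]
  unfold maxDeg
  exact_mod_cast G.degree_le_maxDegree i

lemma sum_sq_incidence_le {n : ℕ} (G : SimpleGraph (Fin n)) (v : Fin n → ℝ) :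
    ∑ e, (incidence G).mulVec v e ^ 2 ≤ 2 * maxDeg G * ∑ i, v i ^ 2 := by
  calc ∑ e, (incidence G).mulVec v e ^ 2
      ≤ ∑ e : Edge G, 2 * (v e.1.1 ^ 2 + v e.1.2 ^ 2) := by
        refine Finset.sum_le_sum fun e _ => ?_
        rw [incidence_mulVec_apply]
        nlinarith [sq_nonneg (v e.1.2 + v e.1.1)]
    _ = 2 * ∑ e : Edge G, (v e.1.1 ^ 2 + v e.1.2 ^ 2) := by rw [Finset.mul_sum]
    _ ≤ 2 * (maxDeg G * ∑ i, v i ^ 2) := by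
        gcongr
        exact sum_edge_add_le G (fun i => v i ^ 2) fun i => sq_nonneg _
    _ = _ := by ring

/-- With u = MᵀMv one has ‖u‖² = ⟨Mv, Mu⟩; Cauchy–Schwarz and the bound for M at both v and u leave
a factor ‖u‖² to cancel. No spectral theory is needed. -/
lemma sum_sq_gram_le {ι κ : Type*} [Fintype ι] [Fintype κ] (M : Matrix ι κ ℝ) {c : ℝ}
    (h : ∀ v, ∑ i, M.mulVec v i ^ 2 ≤ c * ∑ j, v j ^ 2) (v : κ → ℝ) :
    ∑ j, (M.transpose * M).mulVec v j ^ 2 ≤ c ^ 2 * ∑ j, v j ^ 2 := by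
  set u := (M.transpose * M).mulVec v with hu
  have h1 : ∑ j, u j ^ 2 = ∑ i, M.mulVec v i * M.mulVec u i := by
    have : ∑ j, u j ^ 2 = u ⬝ᵥ u := by simp [dotProduct, sq]
    rw [this]
    have h' : u ⬝ᵥ u = (M.transpose.mulVec (M.mulVec v)) ⬝ᵥ u := by
      rw [Matrix.mulVec_mulVec]
    rw [h', Matrix.mulVec_transpose, ← Matrix.dotProduct_mulVec]
    rfl
  have h2 := Finset.sum_mul_sq_le_sq_mul_sq Finset.univ (M.mulVec v) (M.mulVec u)
  rw [← h1] at h2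
  have hv := h v
  have hu' := h u
  have hU : 0 ≤ ∑ j, u j ^ 2 := Finset.sum_nonneg fun _ _ => sq_nonneg _
  have hMv : 0 ≤ ∑ i, M.mulVec v i ^ 2 := Finset.sum_nonneg fun _ _ => sq_nonneg _
  have hMu : 0 ≤ ∑ i, M.mulVec u i ^ 2 := Finset.sum_nonneg fun _ _ => sq_nonneg _
  have h3 : (∑ j, u j ^ 2) ^ 2 ≤ (c * ∑ j, v j ^ 2) * (c * ∑ j, u j ^ 2) :=
    h2.trans (mul_le_mul hv hu' hMu (hMv.trans hv))
  rcases hU.eq_or_lt with h0 | h0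
  · rw [← h0]; positivity
  · nlinarith

lemma sum_sq_pow_le {κ : Type*} [Fintype κ] [DecidableEq κ] (M : Matrix κ κ ℝ) {c : ℝ}
    (hc : 0 ≤ c) (h : ∀ v, ∑ i, M.mulVec v i ^ 2 ≤ c * ∑ j, v j ^ 2) (m : ℕ) (v : κ → ℝ) :
    ∑ j, (M ^ m).mulVec v j ^ 2 ≤ c ^ m * ∑ j, v j ^ 2 := by
  induction m with
  | zero => simp
  | succ m ih =>
    rw [pow_succ', ← Matrix.mulVec_mulVec]
    calc _ ≤ c * ∑ j, (M ^ m).mulVec v j ^ 2 := h _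
      _ ≤ c * (c ^ m * ∑ j, v j ^ 2) := by gcongr
      _ = _ := by ring

/-- The parity is a separate variable `b` because the row type depends on it; this permits a case
split before specializing to `k.bodd`. -/
lemma sum_sq_diffAux_le {n : ℕ} (G : SimpleGraph (Fin n)) (k : ℕ) (b : Bool) (hb : k.bodd = b)
    (v : Fin n → ℝ) :
    ∑ i, (diffAux G k b).mulVec v i ^ 2 ≤ (2 * (maxDeg G : ℝ)) ^ (k + 1) * ∑ j, v j ^ 2 := by
  have hL := sum_sq_pow_le (laplacian G) (sq_nonneg _)
    (sum_sq_gram_le (incidence G) (sum_sq_incidence_le G))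
  have hk := Nat.bodd_add_div2 k
  rw [hb, Nat.div2_val] at hk
  cases b with
  | false =>
    have e : k + 1 = 2 * (k / 2) + 1 := by simp at hk; omega
    change ∑ i, (incidence G * laplacian G ^ (k / 2)).mulVec v i ^ 2 ≤ _
    rw [← Matrix.mulVec_mulVec]
    refine (sum_sq_incidence_le G _).trans ?_
    refine (mul_le_mul_of_nonneg_left (hL (k / 2) v) (by positivity)).trans (le_of_eq ?_)
    conv_rhs => rw [e, pow_succ, pow_mul]
    ring
  | true =>
    have e : k + 1 = 2 * ((k + 1) / 2) := by simp at hk; omega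
    change ∑ i, (laplacian G ^ ((k + 1) / 2)).mulVec v i ^ 2 ≤ _
    refine (hL _ v).trans (le_of_eq ?_)
    conv_rhs => rw [e, pow_mul]

lemma sum_sq_graphDiff_le {n : ℕ} (G : SimpleGraph (Fin n)) (k : ℕ) (v : Fin n → ℝ) :
    ∑ i, (graphDiff G k).mulVec v i ^ 2 ≤ (2 * (maxDeg G : ℝ)) ^ (k + 1) * ∑ j, v j ^ 2 :=
  sum_sq_diffAux_le G k _ rfl v

/-! ### The choice of the graph penalty level -/

/-- The ratio `λ_g / λ` of the two penalty levels. -/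
noncomputable def penaltyRatio (k d : ℕ) : ℝ :=
  (2 : ℝ) ^ (-(1 + (k : ℝ) / 2)) * (d : ℝ) ^ (-(((k : ℝ) + 1) / 2))

lemma penaltyRatio_nonneg (k d : ℕ) : 0 ≤ penaltyRatio k d := by
  unfold penaltyRatio; positivity

lemma penaltyRatio_le_one (k d : ℕ) : penaltyRatio k d ≤ 1 := by
  unfold penaltyRatio
  have h1 : (2 : ℝ) ^ (-(1 + (k : ℝ) / 2)) ≤ 1 :=
    Real.rpow_le_one_of_one_le_of_nonpos one_le_two (by
      have : (0 : ℝ) ≤ k := k.cast_nonneg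
      linarith)
  have h2 : (d : ℝ) ^ (-(((k : ℝ) + 1) / 2)) ≤ 1 := by
    have hk : (0 : ℝ) ≤ k := k.cast_nonneg
    -- For d = 0 the convention that 0 to a nonzero real power is 0 makes the ratio vanish.
    rcases Nat.eq_zero_or_pos d with rfl | hd
    · rw [Nat.cast_zero, Real.zero_rpow (by linarith)]; exact zero_le_one
    · exact Real.rpow_le_one_of_one_le_of_nonpos (by exact_mod_cast hd) (by linarith)
  exact mul_le_one₀ h1 (by positivity) h2

/-- This calibrates λ_g: combined with `sum_sq_graphDiff_le` it makes ρΔ an ℓ₂ contraction. For d >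
0 the product is exactly 1/2. -/
lemma penaltyRatio_sq_mul_le (k d : ℕ) :
    penaltyRatio k d ^ 2 * (2 * (d : ℝ)) ^ (k + 1) ≤ 1 := by
  rcases Nat.eq_zero_or_pos d with rfl | hd
  · simp
  have hd' : (0 : ℝ) < d := by exact_mod_cast hd
  have h1 : ((2 : ℝ) ^ (-(1 + (k : ℝ) / 2))) ^ 2 = 2 ^ (-(2 + (k : ℝ))) := by
    rw [← Real.rpow_natCast, ← Real.rpow_mul (by norm_num)]; congr 1; push_cast; ring
  have h2 : ((d : ℝ) ^ (-(((k : ℝ) + 1) / 2))) ^ 2 = (d : ℝ) ^ (-((k : ℝ) + 1)) := by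
    rw [← Real.rpow_natCast, ← Real.rpow_mul hd'.le]; congr 1; push_cast; ring
  have h3 : (2 * (d : ℝ)) ^ (k + 1) = 2 ^ ((k : ℝ) + 1) * (d : ℝ) ^ ((k : ℝ) + 1) := by
    rw [mul_pow, ← Real.rpow_natCast, ← Real.rpow_natCast]; push_cast; rfl
  have h4 : (2 : ℝ) ^ (-(2 + (k : ℝ))) * 2 ^ ((k : ℝ) + 1) = 2⁻¹ := by
    rw [← Real.rpow_add (by norm_num), ← Real.rpow_neg_one]; congr 1; ring
  have h5 : (d : ℝ) ^ (-((k : ℝ) + 1)) * (d : ℝ) ^ ((k : ℝ) + 1) = 1 := by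
    rw [← Real.rpow_add hd']; simp
  unfold penaltyRatio
  rw [mul_pow, h1, h2, h3]
  calc _ = ((2 : ℝ) ^ (-(2 + (k : ℝ))) * 2 ^ ((k : ℝ) + 1))
        * ((d : ℝ) ^ (-((k : ℝ) + 1)) * (d : ℝ) ^ ((k : ℝ) + 1)) := by ring
    _ ≤ 1 := by rw [h4, h5]; norm_num

/-! ### Weak sparsity -/

open Classical in
-- Take the entries exceeding η. Each contributes at least η^q to the sum, which is Markov's bound
-- on their number; elsewhere |u| = |u|^q |u|^(1-q) ≤ |u|^q η^(1-q).
lemma exists_finset_of_sum_rpow_le {ι : Type*} [Fintype ι] (u : ι → ℝ) {q R η : ℝ}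
    (hq0 : 0 < q) (hq1 : q < 1) (hη : 0 < η) (hR : ∑ i, |u i| ^ q ≤ R) :
    ∃ T : Finset ι, (T.card : ℝ) ≤ R * η ^ (-q) ∧ ∑ i ∈ Tᶜ, |u i| ≤ R * η ^ (1 - q) := by
  refine ⟨Finset.univ.filter fun i => η < |u i|, ?_, ?_⟩
  · rw [Real.rpow_neg hη.le, ← div_eq_mul_inv, le_div_iff₀ (by positivity), ← nsmul_eq_mul]
    refine (Finset.card_nsmul_le_sum _ (fun i => |u i| ^ q) _ fun i hi => ?_).trans
      ((Finset.sum_le_univ_sum_of_nonneg fun i => by positivity).trans hR)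
    exact Real.rpow_le_rpow hη.le (Finset.mem_filter.1 hi).2.le hq0.le
  · calc _ ≤ ∑ i ∈ (Finset.univ.filter fun i => η < |u i|)ᶜ, |u i| ^ q * η ^ (1 - q) := by
          refine Finset.sum_le_sum fun i hi => ?_
          have hi' : |u i| ≤ η := by simpa using hi
          calc |u i| = |u i| ^ q * |u i| ^ (1 - q) := by
                rcases (abs_nonneg (u i)).eq_or_lt with h | h
                · rw [← h, Real.zero_rpow hq0.ne', zero_mul]
                · rw [← Real.rpow_add h]; simp
            _ ≤ _ := by
                gcongr
      _ ≤ _ := by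
          rw [← Finset.sum_mul]
          gcongr
          exact (Finset.sum_le_univ_sum_of_nonneg fun i => by positivity).trans hR

open Classical in
-- The triangle inequality is applied around u on T and around h off T. Keeping the full -‖h‖₁ on
-- the right is what later absorbs the noise.
lemma sum_abs_sub_sum_abs_add_le {ι : Type*} [Fintype ι] (u h : ι → ℝ) (T : Finset ι) :
    ∑ i, |u i| - ∑ i, |u i + h i|
      ≤ 2 * ∑ i ∈ T, |h i| - ∑ i, |h i| + 2 * ∑ i ∈ Tᶜ, |u i| := by
  rw [← Finset.sum_sub_distrib, ← Finset.sum_add_sum_compl T (fun i => |u i| - |u i + h i|),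
    ← Finset.sum_add_sum_compl T (fun i => |h i|), Finset.mul_sum, Finset.mul_sum]
  have h1 : ∑ i ∈ T, (|u i| - |u i + h i|) ≤ ∑ i ∈ T, |h i| := by
    refine Finset.sum_le_sum fun i _ => ?_
    have := abs_sub_abs_le_abs_sub (u i) (u i + h i)
    simpa [abs_sub_comm] using this
  have h2 : ∑ i ∈ Tᶜ, (|u i| - |u i + h i|) ≤ ∑ i ∈ Tᶜ, (2 * |u i| - |h i|) := by
    refine Finset.sum_le_sum fun i _ => ?_
    have := abs_sub_abs_le_abs_sub (h i) (-u i)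
    rw [abs_neg, sub_neg_eq_add, add_comm] at this
    linarith
  rw [Finset.sum_sub_distrib] at h2
  simp only [← Finset.mul_sum, Finset.sum_sub_distrib] at h1 h2 ⊢
  linarith

lemma sum_abs_le_sqrt_card_mul {ι : Type*} [Fintype ι] (h : ι → ℝ) (T : Finset ι) :
    ∑ i ∈ T, |h i| ≤ √T.card * √(∑ i, h i ^ 2) := by
  rw [← Real.sqrt_mul (Nat.cast_nonneg _)]
  refine Real.le_sqrt_of_sq_le ?_
  refine (sq_sum_le_card_mul_sum_sq (s := T) (f := fun i => |h i|)).trans ?_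
  simp only [sq_abs]
  gcongr
  exact Finset.subset_univ T

/-! ### The basic inequality -/

lemma IsGPPLasso.basic_inequality {N n : ℕ} {G : SimpleGraph (Fin n)} {k : ℕ} {lamg lam : ℝ}
    {X : Matrix (Fin N) (Fin n) ℝ} {ε : Fin N → ℝ} {βs b : Fin n → ℝ}
    (hN : 0 < N) (hb : IsGPPLasso G k lamg lam X (X.mulVec βs + ε) b)
    (hnoise : ∀ j, |∑ i, X i j * ε i| ≤ N * (lam / 4)) :
    1 / (2 * (N : ℝ)) * ∑ i, X.mulVec (b - βs) i ^ 2
      ≤ lam / 4 * ∑ j, |b j - βs j|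
        + lamg * (∑ i, |(graphDiff G k).mulVec βs i|
            - ∑ i, |(graphDiff G k).mulVec βs i + (graphDiff G k).mulVec (b - βs) i|)
        + lam * (∑ j, |βs j| - ∑ j, |βs j + (b j - βs j)|) := by
  have h := hb βs
  set v := b - βs with hv
  have e1 : ∀ i, (graphDiff G k).mulVec βs i + (graphDiff G k).mulVec v i
      = (graphDiff G k).mulVec b i := by
    intro i; rw [hv, Matrix.mulVec_sub]; simp
  have e2 : ∀ i, X.mulVec b i = X.mulVec βs i + X.mulVec v i := by
    intro i; rw [hv, Matrix.mulVec_sub]; simp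
  have hN' : (0 : ℝ) < N := by exact_mod_cast hN
  simp only [e1, add_sub_cancel]
  unfold objective at h
  simp only [Pi.add_apply, e2, add_sub_cancel_left] at h
  have e3 : ∑ i, (X.mulVec βs i + ε i - (X.mulVec βs i + X.mulVec v i)) ^ 2
      = ∑ i, ε i ^ 2 - 2 * ∑ i, ε i * X.mulVec v i + ∑ i, X.mulVec v i ^ 2 := by
    rw [Finset.mul_sum, ← Finset.sum_sub_distrib, ← Finset.sum_add_distrib]
    exact Finset.sum_congr rfl fun i _ => by ring
  have e4 : ∑ i, ε i * X.mulVec v i ≤ N * (lam / 4) * ∑ j, |b j - βs j| := by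
    have : ∑ i, ε i * X.mulVec v i = ∑ j, (∑ i, X i j * ε i) * v j := by
      simp only [Matrix.mulVec, dotProduct, Finset.mul_sum, Finset.sum_mul]
      rw [Finset.sum_comm]
      exact Finset.sum_congr rfl fun j _ => Finset.sum_congr rfl fun i _ => by ring
    rw [this, Finset.mul_sum]
    refine Finset.sum_le_sum fun j _ => (le_abs_self _).trans ?_
    rw [abs_mul]
    exact mul_le_mul_of_nonneg_right (hnoise j) (abs_nonneg _)
  rw [e3] at h
  have e5 : 1 / (2 * (N : ℝ)) * (∑ i, ε i ^ 2 - 2 * ∑ i, ε i * X.mulVec v i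
      + ∑ i, X.mulVec v i ^ 2) = 1 / (2 * (N : ℝ)) * ∑ i, ε i ^ 2
        - 1 / N * ∑ i, ε i * X.mulVec v i + 1 / (2 * (N : ℝ)) * ∑ i, X.mulVec v i ^ 2 := by
    field_simp
  have e6 : 1 / (N : ℝ) * ∑ i, ε i * X.mulVec v i ≤ lam / 4 * ∑ j, |b j - βs j| := by
    rw [one_div, inv_mul_le_iff₀ hN']; linarith
  rw [e5] at h
  linarith

/-- Of the -λ‖v‖₁ released by the coordinate penalty, the noise uses a quarter; doubling the
inequality turns the remaining 3/4 into 3/2. What is left on the right comes from the two active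
sets (through ‖v‖₂) and the two tails. -/
lemma IsGPPLasso.cone_inequality {N n : ℕ} {G : SimpleGraph (Fin n)} {k : ℕ} {lam : ℝ}
    {X : Matrix (Fin N) (Fin n) ℝ} {ε : Fin N → ℝ} {βs b : Fin n → ℝ} (hlam : 0 ≤ lam)
    (hN : 0 < N)
    (hb : IsGPPLasso G k (penaltyRatio k (maxDeg G) * lam) lam X (X.mulVec βs + ε) b)
    (hnoise : ∀ j, |∑ i, X i j * ε i| ≤ N * (lam / 4))
    {q₁ q₂ R₁ R₂ η : ℝ} (hq₁ : 0 < q₁) (hq₁' : q₁ < 1) (hq₂ : 0 < q₂) (hq₂' : q₂ < 1)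
    (hη : 0 < η) (hβ : βs ∈ weakSpace G k q₁ q₂ R₁ R₂) :
    ∃ A : ℝ, 0 ≤ A ∧ A ^ 2 ≤ 8 * (R₁ * η ^ (-q₁) + R₂ * η ^ (-q₂)) ∧
      1 / (N : ℝ) * ∑ i, X.mulVec (b - βs) i ^ 2 + 3 / 2 * (lam * ∑ j, |b j - βs j|)
        ≤ 2 * lam * (A * √(∑ j, (b j - βs j) ^ 2)
          + 2 * (R₁ * η ^ (1 - q₁) + R₂ * η ^ (1 - q₂))) := by
  classical
  obtain ⟨S, hS, hS'⟩ := exists_finset_of_sum_rpow_le _ hq₁ hq₁' hη hβ.1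
  obtain ⟨T, hT, hT'⟩ := exists_finset_of_sum_rpow_le _ hq₂ hq₂' hη hβ.2
  refine ⟨2 * √S.card + 2 * √T.card, by positivity, ?_, ?_⟩
  · have h1 := Real.sq_sqrt (Nat.cast_nonneg (α := ℝ) S.card)
    have h2 := Real.sq_sqrt (Nat.cast_nonneg (α := ℝ) T.card)
    nlinarith [sq_nonneg (√(S.card : ℝ) - √(T.card : ℝ))]
  have hbasic := hb.basic_inequality hN hnoise
  set v := b - βs with hv
  set ρ := penaltyRatio k (maxDeg G) with hρ
  have hρ0 : 0 ≤ ρ := penaltyRatio_nonneg _ _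
  have hρ1 : ρ ≤ 1 := penaltyRatio_le_one _ _
  have g1 := sum_abs_sub_sum_abs_add_le ((graphDiff G k).mulVec βs) ((graphDiff G k).mulVec v) S
  have g2 := sum_abs_sub_sum_abs_add_le βs (fun j => b j - βs j) T
  have g3 := sum_abs_le_sqrt_card_mul ((graphDiff G k).mulVec v) S
  have g4 := sum_abs_le_sqrt_card_mul (fun j => b j - βs j) T
  have g5 : 0 ≤ ∑ i, |(graphDiff G k).mulVec v i| := Finset.sum_nonneg fun _ _ => abs_nonneg _
  have g6 : ρ * √(∑ i, (graphDiff G k).mulVec v i ^ 2) ≤ √(∑ j, (b j - βs j) ^ 2) := by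
    rw [← Real.sqrt_sq hρ0, ← Real.sqrt_mul (sq_nonneg _)]
    refine Real.sqrt_le_sqrt ?_
    calc _ ≤ ρ ^ 2 * ((2 * (maxDeg G : ℝ)) ^ (k + 1) * ∑ j, v j ^ 2) := by
          gcongr
          exact sum_sq_graphDiff_le G k v
      _ = (ρ ^ 2 * (2 * (maxDeg G : ℝ)) ^ (k + 1)) * ∑ j, v j ^ 2 := by ring
      _ ≤ 1 * ∑ j, v j ^ 2 := by
          gcongr
          exact penaltyRatio_sq_mul_le _ _
      _ = _ := by simp [hv]
  set D := √(∑ j, (b j - βs j) ^ 2) with hD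
  -- The term -‖Δv‖₁ is discarded. On the active rows ρ is moved onto the ℓ₂ norm of Δv, where the
  -- contraction `g6` applies; on the tail ρ ≤ 1 suffices.
  have g7 : ρ * (∑ i, |(graphDiff G k).mulVec βs i|
      - ∑ i, |(graphDiff G k).mulVec βs i + (graphDiff G k).mulVec v i|)
      ≤ 2 * (√S.card * D) + 2 * (R₁ * η ^ (1 - q₁)) := by
    have hB : 0 ≤ R₁ * η ^ (1 - q₁) :=
      (Finset.sum_nonneg fun _ _ => abs_nonneg _).trans hS'
    calc _ ≤ ρ * (2 * (√S.card * √(∑ i, (graphDiff G k).mulVec v i ^ 2))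
          + 2 * (R₁ * η ^ (1 - q₁))) := by
          gcongr
          linarith
      _ = 2 * (√S.card * (ρ * √(∑ i, (graphDiff G k).mulVec v i ^ 2)))
          + 2 * (ρ * (R₁ * η ^ (1 - q₁))) := by ring
      _ ≤ 2 * (√S.card * D) + 2 * (R₁ * η ^ (1 - q₁)) := by
          have := mul_le_mul_of_nonneg_left g6 (Real.sqrt_nonneg (S.card : ℝ))
          have := mul_le_of_le_one_left hB hρ1
          linarith
  have g8 : ∑ j, |βs j| - ∑ j, |βs j + (b j - βs j)|
      ≤ 2 * (√T.card * D) - ∑ j, |b j - βs j| + 2 * (R₂ * η ^ (1 - q₂)) := by linarith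
  have g9 := mul_le_mul_of_nonneg_left g7 hlam
  have g10 := mul_le_mul_of_nonneg_left g8 hlam
  have g11 : 1 / (2 * (N : ℝ)) * ∑ i, X.mulVec v i ^ 2
      = 1 / 2 * (1 / (N : ℝ) * ∑ i, X.mulVec v i ^ 2) := by ring
  rw [g11] at hbasic
  linarith

end GraphLasso

namespace GraphLasso

/-! ### Moments and tails of sub-Gaussian variables -/

lemma lintegral_ofReal_exp_neg_mul_sub_sq {b : ℝ} (hb : 0 < b) (a : ℝ) :
    ∫⁻ s : ℝ, ENNReal.ofReal (Real.exp (-b * (s - a) ^ 2)) = ENNReal.ofReal √(Real.pi / b) := by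
  rw [lintegral_sub_right_eq_self (fun s : ℝ => ENNReal.ofReal (Real.exp (-b * s ^ 2))) a,
    ← ofReal_integral_eq_lintegral_ofReal (integrable_exp_neg_mul_sq hb)
      (ae_of_all _ fun _ => (Real.exp_pos _).le), integral_gaussian]

variable {Ω : Type*} [MeasurableSpace Ω] {P : Measure Ω} {Y : Ω → ℝ} {σ : ℝ}

/-- Gaussian linearization: exp(y²/(4σ²)) is, up to a constant, the integral over s of exp(sy -
σ²s²). After Tonelli the moment generating function bound leaves another Gaussian integral, and the
ratio of constants is √2. Lower integrals are used because integrability is a consequence. -/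
lemma lintegral_exp_sq_le [IsProbabilityMeasure P] (hY : Measurable Y)
    (hσ : 0 < σ) (h : HasSubgaussianMGF Y ⟨σ ^ 2, sq_nonneg σ⟩ P) :
    ∫⁻ ω, ENNReal.ofReal (Real.exp (1 / (4 * σ ^ 2) * Y ω ^ 2)) ∂P ≤ ENNReal.ofReal 2 := by
  have hσ2 : 0 < σ ^ 2 := by positivity
  have hc : (0 : ℝ) < √(Real.pi / σ ^ 2) := Real.sqrt_pos.2 (by positivity)
  have h1 : ∀ ω, ∫⁻ s : ℝ, ENNReal.ofReal (Real.exp (s * Y ω - σ ^ 2 * s ^ 2))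
      = ENNReal.ofReal √(Real.pi / σ ^ 2)
        * ENNReal.ofReal (Real.exp (1 / (4 * σ ^ 2) * Y ω ^ 2)) := by
    intro ω
    rw [← lintegral_ofReal_exp_neg_mul_sub_sq hσ2 (Y ω / (2 * σ ^ 2)),
      ← lintegral_mul_const' _ _ ENNReal.ofReal_ne_top]
    refine lintegral_congr fun s => ?_
    rw [← ENNReal.ofReal_mul (Real.exp_pos _).le, ← Real.exp_add]
    congr 2
    field_simp
    ring
  have h2 : ∀ s : ℝ, ∫⁻ ω, ENNReal.ofReal (Real.exp (s * Y ω - σ ^ 2 * s ^ 2)) ∂P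
      ≤ ENNReal.ofReal (Real.exp (-(σ ^ 2 / 2) * (s - 0) ^ 2)) := by
    intro s
    have hi : Integrable (fun ω => Real.exp (s * Y ω - σ ^ 2 * s ^ 2)) P := by
      simp only [Real.exp_sub]
      exact (h.integrable_exp_mul s).div_const _
    rw [← ofReal_integral_eq_lintegral_ofReal hi (ae_of_all _ fun _ => (Real.exp_pos _).le)]
    refine ENNReal.ofReal_le_ofReal ?_
    simp only [Real.exp_sub]
    rw [integral_div, div_le_iff₀ (Real.exp_pos _), ← Real.exp_add]
    refine (h.mgf_le s).trans (Real.exp_le_exp.2 (le_of_eq ?_))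
    change σ ^ 2 * s ^ 2 / 2 = -(σ ^ 2 / 2) * (s - 0) ^ 2 + σ ^ 2 * s ^ 2
    ring
  have h3 : ENNReal.ofReal √(Real.pi / σ ^ 2)
      * ∫⁻ ω, ENNReal.ofReal (Real.exp (1 / (4 * σ ^ 2) * Y ω ^ 2)) ∂P
      ≤ ENNReal.ofReal √(Real.pi / (σ ^ 2 / 2)) := by
    rw [← lintegral_const_mul' _ _ ENNReal.ofReal_ne_top]
    simp only [← h1]
    rw [lintegral_lintegral_swap (by fun_prop)]
    refine (lintegral_mono h2).trans (le_of_eq ?_)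
    exact lintegral_ofReal_exp_neg_mul_sub_sq (by positivity) 0
  have h4 : ENNReal.ofReal √(Real.pi / (σ ^ 2 / 2))
      ≤ ENNReal.ofReal √(Real.pi / σ ^ 2) * ENNReal.ofReal 2 := by
    rw [← ENNReal.ofReal_mul hc.le]
    refine ENNReal.ofReal_le_ofReal (Real.sqrt_le_iff.2 ⟨by positivity, ?_⟩)
    rw [mul_pow, Real.sq_sqrt (by positivity)]
    have : 0 < Real.pi / σ ^ 2 := by positivity
    have e : Real.pi / (σ ^ 2 / 2) = 2 * (Real.pi / σ ^ 2) := by field_simp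
    rw [e]; linarith
  exact (ENNReal.mul_le_mul_iff_right (ENNReal.ofReal_pos.2 hc).ne' ENNReal.ofReal_ne_top).1
    (h3.trans h4)

lemma integrable_exp_sq [IsProbabilityMeasure P] (hY : Measurable Y)
    (hσ : 0 < σ) (h : HasSubgaussianMGF Y ⟨σ ^ 2, sq_nonneg σ⟩ P) :
    Integrable (fun ω => Real.exp (1 / (4 * σ ^ 2) * Y ω ^ 2)) P := by
  refine ⟨by fun_prop, ?_⟩
  rw [hasFiniteIntegral_iff_ofReal (ae_of_all _ fun _ => (Real.exp_pos _).le)]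
  exact (lintegral_exp_sq_le hY hσ h).trans_lt ENNReal.ofReal_lt_top

lemma integral_exp_sq_le [IsProbabilityMeasure P] (hY : Measurable Y)
    (hσ : 0 < σ) (h : HasSubgaussianMGF Y ⟨σ ^ 2, sq_nonneg σ⟩ P) :
    ∫ ω, Real.exp (1 / (4 * σ ^ 2) * Y ω ^ 2) ∂P ≤ 2 := by
  rw [← ENNReal.ofReal_le_ofReal_iff (by norm_num), ofReal_integral_eq_lintegral_ofReal
    (integrable_exp_sq hY hσ h) (ae_of_all _ fun _ => (Real.exp_pos _).le)]
  exact lintegral_exp_sq_le hY hσ h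

lemma pow_four_le_exp_sq (hσ : 0 < σ) (y : ℝ) :
    y ^ 4 ≤ 32 * σ ^ 4 * Real.exp (1 / (4 * σ ^ 2) * y ^ 2) := by
  have h := Real.quadratic_le_exp_of_nonneg (x := 1 / (4 * σ ^ 2) * y ^ 2) (by positivity)
  have h' : (1 / (4 * σ ^ 2) * y ^ 2) ^ 2 / 2 ≤ Real.exp (1 / (4 * σ ^ 2) * y ^ 2) := by
    have : 0 ≤ 1 / (4 * σ ^ 2) * y ^ 2 := by positivity
    linarith
  calc y ^ 4 = 32 * σ ^ 4 * ((1 / (4 * σ ^ 2) * y ^ 2) ^ 2 / 2) := by field_simp; ring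
    _ ≤ _ := by gcongr

lemma integrable_pow_four [IsProbabilityMeasure P] (hY : Measurable Y)
    (hσ : 0 < σ) (h : HasSubgaussianMGF Y ⟨σ ^ 2, sq_nonneg σ⟩ P) :
    Integrable (fun ω => Y ω ^ 4) P := by
  refine ((integrable_exp_sq hY hσ h).const_mul (32 * σ ^ 4)).mono' (by fun_prop)
    (ae_of_all _ fun ω => ?_)
  rw [Real.norm_of_nonneg (by positivity)]
  exact pow_four_le_exp_sq hσ _

lemma integral_pow_four_le [IsProbabilityMeasure P] (hY : Measurable Y)
    (hσ : 0 < σ) (h : HasSubgaussianMGF Y ⟨σ ^ 2, sq_nonneg σ⟩ P) :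
    ∫ ω, Y ω ^ 4 ∂P ≤ 64 * σ ^ 4 := by
  calc _ ≤ ∫ ω, 32 * σ ^ 4 * Real.exp (1 / (4 * σ ^ 2) * Y ω ^ 2) ∂P :=
        integral_mono (integrable_pow_four hY hσ h)
          ((integrable_exp_sq hY hσ h).const_mul _) fun ω => pow_four_le_exp_sq hσ _
    _ ≤ 32 * σ ^ 4 * 2 := by
        rw [integral_const_mul]
        gcongr
        exact integral_exp_sq_le hY hσ h
    _ = _ := by ring

lemma integrable_sq_of_subgaussian [IsProbabilityMeasure P]
    (h : HasSubgaussianMGF Y ⟨σ ^ 2, sq_nonneg σ⟩ P) : Integrable (fun ω => Y ω ^ 2) P := by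
  have := (h.memLp 2).integrable_sq
  exact this

/-- The identity (1 + x + x²/2)(1 - x + x²/2) = 1 + x⁴/4 ≥ 1 reduces this to the quadratic lower
bound for exp x. -/
lemma exp_neg_le_quadratic {x : ℝ} (hx : 0 ≤ x) : Real.exp (-x) ≤ 1 - x + x ^ 2 / 2 := by
  have h := Real.quadratic_le_exp_of_nonneg hx
  rw [Real.exp_neg, inv_le_comm₀ (Real.exp_pos _) (by nlinarith [sq_nonneg (x - 1)])]
  refine le_trans ?_ h
  rw [inv_le_iff_one_le_mul₀ (by nlinarith [sq_nonneg (x - 1)])]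
  nlinarith [sq_nonneg (x ^ 2)]

lemma mgf_sq_neg_le [IsProbabilityMeasure P] (hY : Measurable Y)
    (hσ : 0 < σ) (h : HasSubgaussianMGF Y ⟨σ ^ 2, sq_nonneg σ⟩ P) {m t : ℝ}
    (hm : m ≤ ∫ ω, Y ω ^ 2 ∂P) (ht : 0 ≤ t) :
    mgf (fun ω => Y ω ^ 2) P (-t) ≤ Real.exp (-t * m + 32 * σ ^ 4 * t ^ 2) := by
  have i2 := integrable_sq_of_subgaussian h
  have i4 := integrable_pow_four hY hσ h
  have hI : Integrable (fun ω => 1 - t * Y ω ^ 2 + t ^ 2 / 2 * Y ω ^ 4) P :=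
    ((integrable_const _).sub (i2.const_mul t)).add (i4.const_mul _)
  calc mgf (fun ω => Y ω ^ 2) P (-t)
      ≤ ∫ ω, (1 - t * Y ω ^ 2 + t ^ 2 / 2 * Y ω ^ 4) ∂P := by
        refine integral_mono_of_nonneg (ae_of_all _ fun _ => (Real.exp_pos _).le) hI
          (ae_of_all _ fun ω => ?_)
        have := exp_neg_le_quadratic (x := t * Y ω ^ 2) (by positivity)
        simp only [neg_mul]
        refine this.trans (le_of_eq (by ring))
    _ = 1 - t * ∫ ω, Y ω ^ 2 ∂P + t ^ 2 / 2 * ∫ ω, Y ω ^ 4 ∂P := by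
        have hI' : Integrable (fun ω => 1 - t * Y ω ^ 2) P :=
          (integrable_const _).sub (i2.const_mul t)
        rw [integral_add hI' (i4.const_mul _),
          integral_sub (integrable_const _) (i2.const_mul t), integral_const_mul,
          integral_const_mul]
        simp
    _ ≤ 1 - t * m + t ^ 2 / 2 * (64 * σ ^ 4) := by
        have := integral_pow_four_le hY hσ h
        gcongr
    _ = (-t * m + 32 * σ ^ 4 * t ^ 2) + 1 := by ring
    _ ≤ _ := Real.add_one_le_exp _

variable {N : ℕ} {W : Ω → Fin N → ℝ}

/-- Chernoff at 1/(4σ²): the threshold yields e^(-2N), and each factor of the moment generating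
function is at most 2 ≤ e. -/
lemma measure_sum_sq_ge_le [IsProbabilityMeasure P] (hW : Measurable W)
    (hind : iIndepFun (fun i ω => W ω i) P) (hσ : 0 < σ)
    (h : ∀ i, HasSubgaussianMGF (fun ω => W ω i) ⟨σ ^ 2, sq_nonneg σ⟩ P) :
    P.real {ω | 8 * σ ^ 2 * N ≤ ∑ i, W ω i ^ 2} ≤ Real.exp (-N) := by
  have hWi : ∀ i, Measurable fun ω => W ω i := fun i => (measurable_pi_apply i).comp hW
  have hind2 : iIndepFun (fun i ω => W ω i ^ 2) P :=
    hind.comp (fun _ x => x ^ 2) fun _ => by fun_prop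
  have hint : Integrable (fun ω => Real.exp (1 / (4 * σ ^ 2) * (∑ i, fun ω => W ω i ^ 2) ω)) P :=
    hind2.integrable_exp_mul_sum (fun i => by fun_prop)
      fun i _ => integrable_exp_sq (hWi i) hσ (h i)
  have hch := measure_ge_le_exp_mul_mgf (8 * σ ^ 2 * N) (by positivity) hint
  rw [hind2.mgf_sum (fun i => by fun_prop)] at hch
  simp only [Finset.sum_apply] at hch
  refine hch.trans ?_
  have hprod : ∏ i, mgf (fun ω => W ω i ^ 2) P (1 / (4 * σ ^ 2)) ≤ Real.exp 1 ^ N := by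
    refine (Finset.prod_le_prod (g := fun _ => Real.exp 1) (fun i _ => mgf_nonneg) fun i _ =>
      (integral_exp_sq_le (hWi i) hσ (h i)).trans ?_).trans (le_of_eq ?_)
    · linarith [Real.add_one_le_exp (1 : ℝ)]
    · simp
  refine (mul_le_mul_of_nonneg_left hprod (Real.exp_pos _).le).trans (le_of_eq ?_)
  rw [← Real.exp_nat_mul, ← Real.exp_add]
  congr 1
  field_simp
  ring

lemma measure_sum_sq_le_le [IsProbabilityMeasure P] (hW : Measurable W)
    (hind : iIndepFun (fun i ω => W ω i) P) (hσ : 0 < σ)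
    (h : ∀ i, HasSubgaussianMGF (fun ω => W ω i) ⟨σ ^ 2, sq_nonneg σ⟩ P) {m : ℝ} (hm0 : 0 ≤ m)
    (hm : ∀ i, m ≤ ∫ ω, W ω i ^ 2 ∂P) :
    P.real {ω | ∑ i, W ω i ^ 2 ≤ N * (m / 2)} ≤ Real.exp (-(m ^ 2 / (512 * σ ^ 4) * N)) := by
  have hWi : ∀ i, Measurable fun ω => W ω i := fun i => (measurable_pi_apply i).comp hW
  have hind2 : iIndepFun (fun i ω => W ω i ^ 2) P :=
    hind.comp (fun _ x => x ^ 2) fun _ => by fun_prop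
  -- This minimizes the Chernoff exponent -tm/2 + 32σ⁴t² per observation.
  set t := m / (128 * σ ^ 4) with ht
  have ht0 : 0 ≤ t := by positivity
  have hint : Integrable (fun ω => Real.exp (-t * (∑ i, fun ω => W ω i ^ 2) ω)) P := by
    refine Integrable.of_bound (by fun_prop) 1 (ae_of_all _ fun ω => ?_)
    rw [Real.norm_of_nonneg (Real.exp_pos _).le, Real.exp_le_one_iff, Finset.sum_apply]
    have : 0 ≤ ∑ i, W ω i ^ 2 := Finset.sum_nonneg fun _ _ => sq_nonneg _
    nlinarith
  have hch := measure_le_le_exp_mul_mgf (N * (m / 2)) (by linarith) hint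
  rw [hind2.mgf_sum (fun i => by fun_prop)] at hch
  simp only [Finset.sum_apply] at hch
  refine hch.trans ?_
  have hprod : ∏ i, mgf (fun ω => W ω i ^ 2) P (-t)
      ≤ Real.exp (-t * m + 32 * σ ^ 4 * t ^ 2) ^ N := by
    refine (Finset.prod_le_prod (fun i _ => mgf_nonneg) fun i _ =>
      mgf_sq_neg_le (hWi i) hσ (h i) (hm i) ht0).trans (le_of_eq ?_)
    simp
  refine (mul_le_mul_of_nonneg_left hprod (Real.exp_pos _).le).trans (le_of_eq ?_)
  rw [← Real.exp_nat_mul, ← Real.exp_add, ht]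
  congr 1
  field_simp
  ring

lemma hasSubgaussianMGF_mono {c c' : NNReal} (h : HasSubgaussianMGF Y c P) (hc : c ≤ c') :
    HasSubgaussianMGF Y c' P :=
  ⟨h.integrable_exp_mul, fun t => (h.mgf_le t).trans (Real.exp_le_exp.2 (by gcongr))⟩

lemma measure_abs_sum_mul_gt_le [IsProbabilityMeasure P]
    (hind : iIndepFun (fun i ω => W ω i) P)
    (h : ∀ i, HasSubgaussianMGF (fun ω => W ω i) ⟨σ ^ 2, sq_nonneg σ⟩ P)
    (e : Fin N → ℝ) {V u : ℝ} (hV : ∑ i, e i ^ 2 ≤ V) (hu : 0 ≤ u) :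
    P.real {ω | u < |∑ i, W ω i * e i|} ≤ 2 * Real.exp (-u ^ 2 / (2 * (σ ^ 2 * V))) := by
  have hV0 : 0 ≤ V := (Finset.sum_nonneg fun _ _ => sq_nonneg _).trans hV
  have hind2 : iIndepFun (fun i ω => e i * W ω i) P :=
    hind.comp (fun i x => e i * x) fun _ => by fun_prop
  have hc : ∀ i, HasSubgaussianMGF (fun ω => e i * W ω i) (e i ^ 2 * σ ^ 2).toNNReal P := fun i =>
    hasSubgaussianMGF_mono ((h i).const_mul (e i)) (by
      rw [← NNReal.coe_le_coe, Real.coe_toNNReal _ (by positivity)]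
      exact le_of_eq rfl)
  have hs' : HasSubgaussianMGF (fun ω => ∑ i, W ω i * e i) (σ ^ 2 * V).toNNReal P := by
    simp only [mul_comm (W _ _)]
    refine hasSubgaussianMGF_mono
      (HasSubgaussianMGF.sum_of_iIndepFun hind2 (s := Finset.univ) fun i _ => hc i) ?_
    rw [← NNReal.coe_le_coe, Real.coe_toNNReal _ (by positivity), NNReal.coe_sum,
      Finset.sum_congr rfl fun i _ => Real.coe_toNNReal _ (by positivity), ← Finset.sum_mul,
      mul_comm]
    gcongr
  have h1 := hs'.measure_ge_le hu
  have h2 := hs'.neg.measure_ge_le hu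
  simp only [Pi.neg_apply] at h1 h2
  rw [Real.coe_toNNReal _ (by positivity)] at h1 h2
  calc P.real {ω | u < |∑ i, W ω i * e i|}
      ≤ P.real ({ω | u ≤ ∑ i, W ω i * e i} ∪ {ω | u ≤ -∑ i, W ω i * e i}) := by
        refine measureReal_mono fun ω hω => ?_
        rcases lt_abs.1 (show u < |∑ i, W ω i * e i| from hω) with h | h
        · exact Or.inl h.le
        · exact Or.inr h.le
    _ ≤ _ := measureReal_union_le _ _
    _ ≤ _ := by linarith

/-- By independence and Fubini ε may be frozen. Keeping the energy constraint inside the event makes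
the bound uniform: a frozen value either satisfies it, and the fixed-weight tail applies, or its
slice is empty. -/
lemma measure_abs_sum_mul_indep_gt_le [IsProbabilityMeasure P] {ε : Ω → Fin N → ℝ}
    (hW : Measurable W) (hε : Measurable ε) (hWε : IndepFun W ε P)
    (hind : iIndepFun (fun i ω => W ω i) P)
    (h : ∀ i, HasSubgaussianMGF (fun ω => W ω i) ⟨σ ^ 2, sq_nonneg σ⟩ P)
    {V u : ℝ} (hu : 0 ≤ u) :
    P {ω | ∑ i, ε ω i ^ 2 ≤ V ∧ u < |∑ i, W ω i * ε ω i|}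
      ≤ ENNReal.ofReal (2 * Real.exp (-u ^ 2 / (2 * (σ ^ 2 * V)))) := by
  set B : Set ((Fin N → ℝ) × (Fin N → ℝ)) :=
    {p | ∑ i, p.1 i ^ 2 ≤ V ∧ u < |∑ i, p.2 i * p.1 i|} with hB
  have hBm : MeasurableSet B := by
    have h1 : Measurable fun p : (Fin N → ℝ) × (Fin N → ℝ) => ∑ i, p.2 i * p.1 i := by fun_prop
    have h2 : Measurable fun p : (Fin N → ℝ) × (Fin N → ℝ) => ∑ i, p.1 i ^ 2 := by fun_prop
    exact (measurableSet_le h2 measurable_const).inter (measurableSet_lt measurable_const h1.abs)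
  have h1 : P {ω | ∑ i, ε ω i ^ 2 ≤ V ∧ u < |∑ i, W ω i * ε ω i|}
      = (P.map fun ω => (ε ω, W ω)) B := by
    rw [Measure.map_apply (hε.prodMk hW) hBm]; rfl
  have hprob : IsProbabilityMeasure (P.map ε) := Measure.isProbabilityMeasure_map hε.aemeasurable
  rw [h1, (indepFun_iff_map_prod_eq_prod_map_map hε.aemeasurable hW.aemeasurable).1 hWε.symm,
    Measure.prod_apply hBm]
  calc _ ≤ ∫⁻ _, ENNReal.ofReal (2 * Real.exp (-u ^ 2 / (2 * (σ ^ 2 * V)))) ∂(P.map ε) := by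
        refine lintegral_mono fun e => ?_
        rw [Measure.map_apply hW (measurable_prodMk_left hBm)]
        by_cases he : ∑ i, e i ^ 2 ≤ V
        · have := measure_abs_sum_mul_gt_le hind h e he hu
          rw [measureReal_def] at this
          refine (ENNReal.le_ofReal_iff_toReal_le (measure_ne_top _ _) (by positivity)).2
            (le_trans (le_of_eq ?_) this)
          congr 2
          ext ω
          simp [hB, he]
        · have : W ⁻¹' (Prod.mk e ⁻¹' B) = ∅ := by
            ext ω; simp [hB, he]
          simp [this]
    _ = _ := by simp

end GraphLasso

namespace GraphLasso

/-! ### Empirical approximation by sparse vectors -/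

lemma exists_le_weighted_sum {ι : Type*} [Fintype ι] {p g : ι → ℝ} (hp : ∀ i, 0 ≤ p i)
    (hp1 : ∑ i, p i = 1) : ∃ i, g i ≤ ∑ i, p i * g i := by
  by_contra! h
  have h0 : ∑ i, p i * (g i - ∑ i, p i * g i) = 0 := by
    simp only [mul_sub, Finset.sum_sub_distrib, ← Finset.sum_mul, hp1, one_mul, sub_self]
  rw [Finset.sum_eq_zero_iff_of_nonneg fun i _ => mul_nonneg (hp i) (sub_nonneg.2 (h i).le)] at h0
  have h1 : ∀ i, p i = 0 := fun i =>
    (mul_eq_zero.1 (h0 i (Finset.mem_univ i))).resolve_right (sub_pos.2 (h i)).ne'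
  simp [h1] at hp1

/-- The right side is the expectation of the form at y plus r independent draws from the z's with
weights p. The draws are chosen one at a time, never exceeding the conditional expectation, so no
product measure is needed, and the form need not be positive. -/
lemma exists_sum_quadratic_le {ι E : Type*} [Fintype ι] [AddCommGroup E] [Module ℝ E]
    (B : E →ₗ[ℝ] E →ₗ[ℝ] ℝ) (hB : ∀ x y, B x y = B y x) {p : ι → ℝ} (hp : ∀ i, 0 ≤ p i)
    (hp1 : ∑ i, p i = 1) (z : ι → E) (r : ℕ) (y : E) :
    ∃ f : Fin r → ι, B (y + ∑ i, z (f i)) (y + ∑ i, z (f i))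
      ≤ B y y + 2 * r * B y (∑ i, p i • z i)
        + r * (r - 1) * B (∑ i, p i • z i) (∑ i, p i • z i) + r * ∑ i, p i * B (z i) (z i) := by
  set m := ∑ i, p i • z i with hm
  have hlin : ∀ x, ∑ i, p i * B x (z i) = B x m := by
    intro x; simp [hm, map_sum]
  induction r generalizing y with
  | zero => exact ⟨Fin.elim0, by simp⟩
  | succ r ih =>
    -- The averaged quantity is the part of the inductive bound that depends on the newly chosen
    -- vector.
    obtain ⟨i, hi⟩ := exists_le_weighted_sum (g := fun i => B (y + z i) (y + z i)
      + 2 * r * B (y + z i) m) hp hp1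
    obtain ⟨f, hf⟩ := ih (y + z i)
    refine ⟨Fin.cons i f, ?_⟩
    have e : y + ∑ j, z ((Fin.cons i f : Fin (r + 1) → ι) j) = y + z i + ∑ j, z (f j) := by
      rw [Fin.sum_univ_succ]; simp [add_assoc]
    rw [e]
    have h1 : ∑ i, p i * (B (y + z i) (y + z i) + 2 * r * B (y + z i) m)
        = B y y + 2 * B y m + ∑ i, p i * B (z i) (z i) + 2 * r * (B y m + B m m) := by
      have hz : ∀ i, p i * (B (y + z i) (y + z i) + 2 * r * B (y + z i) m)
          = p i * B y y + 2 * (p i * B y (z i)) + p i * B (z i) (z i)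
            + 2 * r * (p i * B y m + p i * B m (z i)) := by
        intro i
        simp only [map_add, LinearMap.add_apply, hB (z i) y, hB (z i) m]
        ring
      simp only [hz, Finset.sum_add_distrib, ← Finset.mul_sum, ← Finset.sum_mul, hp1, hlin,
        one_mul]
    push_cast
    rw [h1] at hi
    linarith

/-- The signed standard basis vector `± e_j`. -/
def signedBasis {n : ℕ} (a : Fin n × Bool) : Fin n → ℝ :=
  Pi.single a.1 (if a.2 then 1 else -1)

/-- Maurey's argument for the form B = XᵀX/N - κI: with weights |v_j|/‖v‖₁ the sampled vectors have
mean v/‖v‖₁. Some sum of s draws has B at most its expectation s(s-1)B(mean, mean) + s·(diagonal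
average), while sparsity makes B nonnegative there. The diagonal average is at most C, which becomes
the slack. -/
lemma restricted_eigenvalue_of_sparse {N n s : ℕ} (X : Matrix (Fin N) (Fin n) ℝ) {κ C : ℝ}
    (hκ : 0 ≤ κ) (hs : 2 ≤ s)
    (hsparse : ∀ f : Fin s → Fin n × Bool, κ * ∑ j, (∑ i, signedBasis (f i)) j ^ 2
      ≤ 1 / (N : ℝ) * ∑ l, X.mulVec (∑ i, signedBasis (f i)) l ^ 2)
    (hdiag : ∀ j, 1 / (N : ℝ) * ∑ l, X l j ^ 2 ≤ C) (v : Fin n → ℝ) :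
    κ * ∑ j, v j ^ 2
      ≤ 1 / (N : ℝ) * ∑ l, X.mulVec v l ^ 2 + C / (s - 1) * (∑ j, |v j|) ^ 2 := by
  set ℓ := ∑ j, |v j| with hℓ
  have hℓ0 : 0 ≤ ℓ := Finset.sum_nonneg fun _ _ => abs_nonneg _
  rcases hℓ0.eq_or_lt with h0 | hℓpos
  · have hv : v = 0 := by
      ext j
      have := (Finset.sum_eq_zero_iff_of_nonneg fun _ _ => abs_nonneg _).1 (hℓ.symm.trans h0.symm)
        j (Finset.mem_univ j)
      simpa using this
    rw [← h0]; simp [hv]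
  let B : (Fin n → ℝ) →ₗ[ℝ] (Fin n → ℝ) →ₗ[ℝ] ℝ := LinearMap.mk₂ ℝ
    (fun x y => 1 / (N : ℝ) * (X.mulVec x ⬝ᵥ X.mulVec y) - κ * (x ⬝ᵥ y))
    (fun x x' y => by simp only [Matrix.mulVec_add, add_dotProduct]; ring)
    (fun c x y => by simp only [Matrix.mulVec_smul, smul_dotProduct, smul_eq_mul]; ring)
    (fun x y y' => by simp only [Matrix.mulVec_add, dotProduct_add]; ring)
    (fun c x y => by simp only [Matrix.mulVec_smul, dotProduct_smul, smul_eq_mul]; ring)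
  have hBapp : ∀ x, B x x = 1 / (N : ℝ) * ∑ l, X.mulVec x l ^ 2 - κ * ∑ j, x j ^ 2 := by
    intro x; simp [B, dotProduct, sq]
  have hBsymm : ∀ x y, B x y = B y x := by
    intro x y; simp [B, dotProduct_comm]
  have hp1 : ∑ j, |v j| / ℓ = 1 := by rw [← Finset.sum_div]; exact div_self hℓpos.ne'
  obtain ⟨f, hf⟩ := exists_sum_quadratic_le B hBsymm (p := fun j => |v j| / ℓ)
    (fun j => by positivity) hp1 (fun j => signedBasis (j, decide (0 ≤ v j))) s 0
  have hm : ∑ j, (|v j| / ℓ) • signedBasis (j, decide (0 ≤ v j)) = ℓ⁻¹ • v := by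
    ext a
    simp only [Finset.sum_apply, Pi.smul_apply, signedBasis, Pi.single_apply, smul_eq_mul,
      mul_ite, mul_zero, Finset.sum_ite_eq, Finset.mem_univ, if_true, decide_eq_true_eq]
    split_ifs with h
    · rw [abs_of_nonneg h]; field_simp
    · rw [abs_of_neg (not_le.1 h)]; field_simp
  have hz : ∀ j, B (signedBasis (j, decide (0 ≤ v j))) (signedBasis (j, decide (0 ≤ v j)))
      ≤ C := by
    intro j
    rw [hBapp]
    have h1 : ∀ l, X.mulVec (signedBasis (j, decide (0 ≤ v j))) l ^ 2 = X l j ^ 2 := by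
      intro l
      simp only [signedBasis, Matrix.mulVec_single, Pi.smul_apply, Matrix.col_apply]
      split_ifs <;> simp
    have h2 : 0 ≤ κ * ∑ a, signedBasis (j, decide (0 ≤ v j)) a ^ 2 :=
      mul_nonneg hκ (Finset.sum_nonneg fun _ _ => sq_nonneg _)
    simp only [h1]
    linarith [hdiag j]
  have hzsum : ∑ j, |v j| / ℓ
      * B (signedBasis (j, decide (0 ≤ v j))) (signedBasis (j, decide (0 ≤ v j))) ≤ C := by
    calc _ ≤ ∑ j, |v j| / ℓ * C := by
          gcongr with j
          exact hz j
      _ = C := by rw [← Finset.sum_mul, hp1, one_mul]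
  have hpos : 0 ≤ B (∑ i, signedBasis (f i, decide (0 ≤ v (f i))))
      (∑ i, signedBasis (f i, decide (0 ≤ v (f i)))) := by
    rw [hBapp]
    exact sub_nonneg.2 (hsparse fun i => (f i, decide (0 ≤ v (f i))))
  simp only [hm, zero_add, map_zero, LinearMap.zero_apply, mul_zero, map_smul,
    LinearMap.smul_apply, smul_eq_mul, hBapp v] at hf
  set D := 1 / (N : ℝ) * ∑ l, X.mulVec v l ^ 2 - κ * ∑ j, v j ^ 2 with hD
  have hs' : (2 : ℝ) ≤ s := by exact_mod_cast hs
  have h3 : 0 ≤ (s : ℝ) * ((s - 1) * (ℓ⁻¹ * (ℓ⁻¹ * D)) + C) := by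
    have := mul_le_mul_of_nonneg_left hzsum (by linarith : (0 : ℝ) ≤ s)
    linarith
  have h4 : 0 ≤ (s - 1) * (ℓ⁻¹ * (ℓ⁻¹ * D)) + C :=
    nonneg_of_mul_nonneg_right h3 (by linarith)
  have h5 : 0 ≤ D + C / (s - 1) * ℓ ^ 2 := by
    -- Undo the normalization by ℓ and divide by s - 1; this needs s ≥ 2.
    have h6 : D + C / (s - 1) * ℓ ^ 2
        = ((s - 1) * (ℓ⁻¹ * (ℓ⁻¹ * D)) + C) * (ℓ ^ 2 / (s - 1)) := by
      have : (s : ℝ) - 1 ≠ 0 := by linarith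
      field_simp
    rw [h6]
    exact mul_nonneg h4 (div_nonneg (sq_nonneg _) (by linarith))
  linarith

/-! ### The restricted eigenvalue condition for sub-Gaussian designs -/

lemma mul_sum_sq_le_dotProduct_mulVec {n : ℕ} {S : Matrix (Fin n) (Fin n) ℝ}
    (hS : S.IsHermitian) {c : ℝ} (hc : ∀ μ ∈ spectrum ℝ S, c ≤ μ) (u : Fin n → ℝ) :
    c * ∑ j, u j ^ 2 ≤ u ⬝ᵥ S.mulVec u := by
  have hpsd : (S - algebraMap ℝ _ c).PosSemidef := by
    rw [Matrix.posSemidef_iff_isHermitian_and_spectrum_nonneg]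
    refine ⟨hS.sub ?_, ?_⟩
    · rw [Algebra.algebraMap_eq_smul_one]
      simp [Matrix.IsHermitian]
    · intro μ hμ
      rw [← spectrum.sub_singleton_eq] at hμ
      obtain ⟨ν, hν, _, rfl, rfl⟩ := Set.mem_sub.1 hμ
      exact sub_nonneg.2 (hc ν hν)
  have h := hpsd.dotProduct_mulVec_nonneg u
  rw [Matrix.sub_mulVec, Algebra.algebraMap_eq_smul_one, Matrix.smul_mulVec, Matrix.one_mulVec,
    dotProduct_sub, dotProduct_smul] at h
  have e : u ⬝ᵥ u = ∑ j, u j ^ 2 := by simp [dotProduct, sq]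
  simp only [star_trivial, e, smul_eq_mul] at h
  linarith

variable {Ω : Type*} [MeasurableSpace Ω] {P : Measure Ω} {N n : ℕ} {X : Ω → Fin N → Fin n → ℝ}
  {σ : ℝ} {S : Matrix (Fin n) (Fin n) ℝ}

namespace IsRowwiseSubGaussian

lemma measurable_entry (h : IsRowwiseSubGaussian P X σ S) (i : Fin N) (j : Fin n) :
    Measurable fun ω => X ω i j :=
  (measurable_pi_apply j).comp ((measurable_pi_apply i).comp h.measurable)

lemma subgaussian_entry (h : IsRowwiseSubGaussian P X σ S) (i : Fin N) (j : Fin n) :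
    HasSubgaussianMGF (fun ω => X ω i j) ⟨σ ^ 2, sq_nonneg σ⟩ P := by
  have := ((h.subGaussian i).2 (Pi.single j 1) (by simp [Pi.single_apply])).2
  simpa [Pi.single_apply] using this

lemma isHermitian (h : IsRowwiseSubGaussian P X σ S) (hN : 0 < N) : S.IsHermitian := by
  ext a b
  simp only [Matrix.conjTranspose_apply, star_trivial]
  rw [← h.covariance ⟨0, hN⟩, ← h.covariance ⟨0, hN⟩, covariance_comm]

lemma integral_sq_eq [IsProbabilityMeasure P] (h : IsRowwiseSubGaussian P X σ S) (i : Fin N)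
    (u : Fin n → ℝ) : ∫ ω, (∑ j, u j * X ω i j) ^ 2 ∂P = u ⬝ᵥ S.mulVec u := by
  have hL : ∀ j, MemLp (fun ω => X ω i j) 2 P := fun j => (h.subgaussian_entry i j).memLp 2
  have hI : ∀ a b, Integrable (fun ω => X ω i a * X ω i b) P := fun a b =>
    (hL a).integrable_mul (hL b)
  have hS : ∀ a b, ∫ ω, X ω i a * X ω i b ∂P = S a b := by
    intro a b
    rw [← h.covariance i a b, covariance_eq_sub (hL a) (hL b), (h.subGaussian i).1 a]
    simp
  have e : ∀ ω, (∑ j, u j * X ω i j) ^ 2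
      = ∑ a, ∑ b, u a * u b * (X ω i a * X ω i b) := by
    intro ω
    rw [sq, Finset.sum_mul_sum]
    exact Finset.sum_congr rfl fun a _ => Finset.sum_congr rfl fun b _ => by ring
  simp only [e]
  rw [integral_finsetSum _ fun a _ => integrable_finsetSum _ fun b _ => (hI a b).const_mul _]
  simp only [dotProduct, Matrix.mulVec, Finset.mul_sum]
  refine Finset.sum_congr rfl fun a _ => ?_
  rw [integral_finsetSum _ fun b _ => (hI a b).const_mul _]
  refine Finset.sum_congr rfl fun b _ => ?_
  rw [integral_const_mul, hS]
  ring

/-- After normalizing w, the projected rows are independent sub-Gaussian with second moment at least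
c, so the lower tail bound applies with m = c. -/
lemma measure_direction_le [IsProbabilityMeasure P] (h : IsRowwiseSubGaussian P X σ S)
    (hN : 0 < N) (hσ : 0 < σ) {c : ℝ} (hc0 : 0 < c) (hc : ∀ μ ∈ spectrum ℝ S, c ≤ μ)
    (w : Fin n → ℝ) :
    P.real {ω | 1 / (N : ℝ) * ∑ l, (Matrix.of (X ω)).mulVec w l ^ 2 < c / 2 * ∑ j, w j ^ 2}
      ≤ Real.exp (-(c ^ 2 / (512 * σ ^ 4) * N)) := by
  have hN' : (0 : ℝ) < N := by exact_mod_cast hN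
  have hw0 : 0 ≤ ∑ j, w j ^ 2 := Finset.sum_nonneg fun _ _ => sq_nonneg _
  rcases hw0.eq_or_lt with h0 | hwpos
  · have : {ω | 1 / (N : ℝ) * ∑ l, (Matrix.of (X ω)).mulVec w l ^ 2 < c / 2 * ∑ j, w j ^ 2}
        = ∅ := by
      ext ω
      simp only [Set.mem_ofPred_eq, Set.mem_empty_iff_false, iff_false, not_lt, ← h0, mul_zero]
      positivity
    rw [this]; simp [Real.exp_nonneg]
  set D := √(∑ j, w j ^ 2) with hD
  have hDpos : 0 < D := Real.sqrt_pos.2 hwpos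
  have hD2 : D ^ 2 = ∑ j, w j ^ 2 := Real.sq_sqrt hw0
  have hu : ∑ j, (w j / D) ^ 2 = 1 := by
    simp only [div_pow, ← Finset.sum_div, hD2]
    exact div_self hwpos.ne'
  have hm : ∀ i, c ≤ ∫ ω, (∑ j, w j / D * X ω i j) ^ 2 ∂P := by
    intro i
    rw [h.integral_sq_eq i fun j => w j / D]
    have := mul_sum_sq_le_dotProduct_mulVec (h.isHermitian hN) hc fun j => w j / D
    rwa [hu, mul_one] at this
  have hX := h.measurable
  have hind : iIndepFun (fun i ω => ∑ j, w j / D * X ω i j) P :=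
    h.indep.comp (fun _ x => ∑ j, w j / D * x j) fun _ => by fun_prop
  have hWm : Measurable fun ω (i : Fin N) => ∑ j, w j / D * X ω i j :=
    measurable_pi_lambda _ fun i => Finset.measurable_sum _ fun j _ =>
      (h.measurable_entry i j).const_mul _
  have key := measure_sum_sq_le_le (W := fun ω i => ∑ j, w j / D * X ω i j) hWm hind hσ
    (fun i => ((h.subGaussian i).2 _ hu).2) hc0.le hm
  refine (measureReal_mono fun ω hω => ?_).trans key
  have e : ∀ l, (Matrix.of (X ω)).mulVec w l ^ 2
      = D ^ 2 * (∑ j, w j / D * X ω l j) ^ 2 := by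
    intro l
    rw [← mul_pow, Finset.mul_sum]
    congr 1
    simp only [Matrix.mulVec, dotProduct, Matrix.of_apply]
    refine Finset.sum_congr rfl fun j _ => ?_
    field_simp
  simp only [Set.mem_ofPred_eq, e, ← Finset.mul_sum, ← hD2] at hω ⊢
  rw [one_div, inv_mul_lt_iff₀ hN'] at hω
  refine le_of_mul_le_mul_left (hω.le.trans (le_of_eq ?_)) (pow_pos hDpos 2)
  ring

lemma measure_column_le [IsProbabilityMeasure P] (h : IsRowwiseSubGaussian P X σ S)
    (hN : 0 < N) (hσ : 0 < σ) (j : Fin n) :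
    P.real {ω | 8 * σ ^ 2 < 1 / (N : ℝ) * ∑ l, X ω l j ^ 2} ≤ Real.exp (-N) := by
  have hN' : (0 : ℝ) < N := by exact_mod_cast hN
  have hind : iIndepFun (fun i ω => X ω i j) P :=
    h.indep.comp (fun _ x => x j) fun _ => by fun_prop
  have key := measure_sum_sq_ge_le (W := fun ω i => X ω i j)
    (measurable_pi_lambda _ fun i => h.measurable_entry i j) hind hσ
    fun i => h.subgaussian_entry i j
  refine (measureReal_mono fun ω hω => ?_).trans key
  simp only [Set.mem_ofPred_eq] at hω ⊢
  rw [one_div, lt_inv_mul_iff₀ hN'] at hω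
  linarith

end IsRowwiseSubGaussian

/-- The exponential rate in the restricted eigenvalue bound. -/
noncomputable def reRate (σ c : ℝ) : ℝ := min (c ^ 2 / (2048 * σ ^ 4)) (1 / 2)

/-- The tolerance constant in the restricted eigenvalue bound. -/
noncomputable def reTol (σ c : ℝ) : ℝ := (c + 24 * σ ^ 2) / reRate σ c

lemma reRate_pos {σ c : ℝ} (hσ : 0 < σ) (hc : 0 < c) : 0 < reRate σ c :=
  lt_min (by positivity) (by norm_num)

lemma reTol_pos {σ c : ℝ} (hσ : 0 < σ) (hc : 0 < c) : 0 < reTol σ c :=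
  div_pos (by positivity) (reRate_pos hσ hc)

/-- The sparsity s is as large as the union bound permits: the (2n)^s sums cost at most e^(2rN),
against a failure probability of at most e^(-4rN) for each. -/
theorem IsRowwiseSubGaussian.measure_not_restricted_eigenvalue_le [IsProbabilityMeasure P]
    (h : IsRowwiseSubGaussian P X σ S) (hN : 0 < N) (hn : 2 ≤ n) (hσ : 0 < σ) {c : ℝ}
    (hc0 : 0 < c) (hc : ∀ μ ∈ spectrum ℝ S, c ≤ μ) :
    P.real {ω | ¬ ∀ v : Fin n → ℝ, c / 2 * ∑ j, v j ^ 2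
        ≤ 1 / (N : ℝ) * ∑ l, (Matrix.of (X ω)).mulVec v l ^ 2
          + reTol σ c * (Real.log n / N) * (∑ j, |v j|) ^ 2}
      ≤ 2 * Real.exp (-(reRate σ c * N)) := by
  have hN' : (0 : ℝ) < N := by exact_mod_cast hN
  have hn' : (2 : ℝ) ≤ n := by exact_mod_cast hn
  have hr := reRate_pos hσ hc0
  have hlog : 0 < Real.log n := Real.log_pos (by linarith)
  set r := reRate σ c with hrdef
  set ρ := Real.log n / N with hρ
  have hρ0 : 0 < ρ := by positivity
  have hTr : reTol σ c = (c + 24 * σ ^ 2) / r := rfl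
  set s := ⌊r / ρ⌋₊ with hs
  have hs1 : (s : ℝ) ≤ r / ρ := Nat.floor_le (by positivity)
  have hs2 : r / ρ < s + 1 := Nat.lt_floor_add_one _
  rcases lt_or_ge s 2 with hlt | hge
  · have hempty : {ω | ¬ ∀ v : Fin n → ℝ, c / 2 * ∑ j, v j ^ 2
        ≤ 1 / (N : ℝ) * ∑ l, (Matrix.of (X ω)).mulVec v l ^ 2
          + reTol σ c * ρ * (∑ j, |v j|) ^ 2} = ∅ := by
      ext ω
      simp only [Set.mem_ofPred_eq, Set.mem_empty_iff_false, iff_false, not_not]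
      intro v
      have h1 : ∑ j, v j ^ 2 ≤ (∑ j, |v j|) ^ 2 := by
        have := Finset.sum_sq_le_sq_sum_of_nonneg (s := Finset.univ) (f := fun j => |v j|)
          fun _ _ => abs_nonneg _
        simpa using this
      -- When s < 2 the ratio log n / N exceeds r/2, so the slack alone dominates, through ‖v‖₂ ≤
      -- ‖v‖₁.
      have h2 : c / 2 ≤ reTol σ c * ρ := by
        have h3 : (s : ℝ) + 1 ≤ 2 := by
          have : s + 1 ≤ 2 := hlt
          exact_mod_cast this
        have h4 : r < 2 * ρ := (div_lt_iff₀ hρ0).1 (hs2.trans_le h3)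
        rw [hTr, div_mul_eq_mul_div, le_div_iff₀ hr]
        nlinarith [mul_pos (pow_pos hσ 2) hρ0]
      have h5 : 0 ≤ 1 / (N : ℝ) * ∑ l, (Matrix.of (X ω)).mulVec v l ^ 2 := by positivity
      have hT0 : 0 ≤ reTol σ c * ρ := by linarith
      have h6 : c / 2 * ∑ j, v j ^ 2 ≤ reTol σ c * ρ * (∑ j, |v j|) ^ 2 := by gcongr
      linarith
    rw [hempty]
    simp only [measureReal_empty]
    positivity
  · set E : Set Ω := ⋃ f : Fin s → Fin n × Bool,
      {ω | 1 / (N : ℝ) * ∑ l, (Matrix.of (X ω)).mulVec (∑ i, signedBasis (f i)) l ^ 2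
        < c / 2 * ∑ j, (∑ i, signedBasis (f i)) j ^ 2} with hE
    set F : Set Ω := ⋃ j : Fin n, {ω | 8 * σ ^ 2 < 1 / (N : ℝ) * ∑ l, X ω l j ^ 2} with hF
    have hsub : {ω | ¬ ∀ v : Fin n → ℝ, c / 2 * ∑ j, v j ^ 2
        ≤ 1 / (N : ℝ) * ∑ l, (Matrix.of (X ω)).mulVec v l ^ 2
          + reTol σ c * ρ * (∑ j, |v j|) ^ 2} ⊆ E ∪ F := by
      intro ω hω
      by_contra hcon
      refine hω fun v => ?_
      simp only [hE, hF, Set.mem_union, Set.mem_iUnion, Set.mem_ofPred_eq, not_or, not_exists,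
        not_lt] at hcon
      have := restricted_eigenvalue_of_sparse (Matrix.of (X ω)) (half_pos hc0).le hge
        hcon.1 hcon.2 v
      refine this.trans ?_
      have hge' : (2 : ℝ) ≤ s := by exact_mod_cast hge
      have h7 : 8 * σ ^ 2 / (s - 1) ≤ reTol σ c * ρ := by
        -- Here s + 1 ≤ 3(s - 1) because s ≥ 2; this 3 turns the column bound 8σ² into the 24σ² of
        -- `reTol`.
        have h8 : r ≤ 3 * (s - 1) * ρ := by
          have := (div_lt_iff₀ hρ0).1 hs2
          nlinarith
        rw [hTr, div_mul_eq_mul_div, div_le_div_iff₀ (by linarith) hr]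
        have h9 : 8 * σ ^ 2 * r ≤ 8 * σ ^ 2 * (3 * (s - 1) * ρ) := by gcongr
        have h10 : 0 ≤ c * ρ * (s - 1) := mul_nonneg (by positivity) (by linarith)
        linarith
      gcongr
    have hslog : s * Real.log n ≤ r * N := by
      rw [le_div_iff₀ hρ0, hρ, mul_div_assoc', div_le_iff₀ hN'] at hs1
      exact hs1
    have hexpn : (n : ℝ) = Real.exp (Real.log n) := (Real.exp_log (by linarith)).symm
    have hEle : P.real E ≤ Real.exp (-(r * N)) := by
      calc P.real E ≤ ∑ f : Fin s → Fin n × Bool, Real.exp (-(c ^ 2 / (512 * σ ^ 4) * N)) :=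
            (measureReal_iUnion_fintype_le _).trans
              (Finset.sum_le_sum fun f _ => h.measure_direction_le hN hσ hc0 hc _)
        _ = (n * 2 : ℝ) ^ s * Real.exp (-(c ^ 2 / (512 * σ ^ 4) * N)) := by
            simp
        _ ≤ (Real.exp (2 * Real.log n)) ^ s * Real.exp (-(c ^ 2 / (512 * σ ^ 4) * N)) := by
            gcongr
            rw [two_mul, Real.exp_add, ← hexpn]
            gcongr
        _ = Real.exp (2 * (s * Real.log n) - c ^ 2 / (512 * σ ^ 4) * N) := by
            rw [← Real.exp_nat_mul, ← Real.exp_add]; congr 1; ring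
        _ ≤ Real.exp (-(r * N)) := by
            refine Real.exp_le_exp.2 ?_
            have h11 : 4 * r ≤ c ^ 2 / (512 * σ ^ 4) := by
              have : r ≤ c ^ 2 / (2048 * σ ^ 4) := min_le_left _ _
              calc 4 * r ≤ 4 * (c ^ 2 / (2048 * σ ^ 4)) := by linarith
                _ = _ := by field_simp; norm_num
            have := mul_le_mul_of_nonneg_right h11 hN'.le
            nlinarith [mul_pos hr hN']
    have hFle : P.real F ≤ Real.exp (-(r * N)) := by
      calc P.real F ≤ ∑ j : Fin n, Real.exp (-(N : ℝ)) :=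
            (measureReal_iUnion_fintype_le _).trans
              (Finset.sum_le_sum fun j _ => h.measure_column_le hN hσ j)
        _ = Real.exp (Real.log n) * Real.exp (-(N : ℝ)) := by
            rw [← hexpn]; simp
        _ ≤ _ := by
            rw [← Real.exp_add]
            refine Real.exp_le_exp.2 ?_
            have hge' : (2 : ℝ) ≤ s := by exact_mod_cast hge
            have hr2 : r ≤ 1 / 2 := min_le_right _ _
            nlinarith
    calc _ ≤ P.real (E ∪ F) := measureReal_mono hsub
      _ ≤ P.real E + P.real F := measureReal_union_le _ _
      _ ≤ _ := by linarith

end GraphLasso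

namespace GraphLasso

/-! ### The noise level -/

section Noise

variable {Ω : Type*} [MeasurableSpace Ω] {P : Measure Ω} {N n : ℕ} {X : Ω → Fin N → Fin n → ℝ}
  {ε : Ω → Fin N → ℝ} {σ σε : ℝ} {S : Matrix (Fin n) (Fin n) ℝ}

/-- Off an event of probability e^(-N) the noise energy is at most 8σε²N. Given such ε, each column
exceeds the level u with probability at most 2n^(-4), and a union over n columns stays below 2/n.
The 32 is 4 (from λ/4) times the 8 in u. -/
theorem IsRowwiseSubGaussian.measure_noise_gt_le [IsProbabilityMeasure P]
    (h : IsRowwiseSubGaussian P X σ S) (hε : IsSubGaussianNoise P ε σε) (hXε : IndepFun X ε P)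
    (hN : 0 < N) (hn : 2 ≤ n) (hσ : 0 < σ) (hσε : 0 < σε) {lam : ℝ}
    (hlam : 32 * σ * (σε * √(Real.log n / N)) ≤ lam) :
    P {ω | ¬ ∀ j, |∑ i, X ω i j * ε ω i| ≤ N * (lam / 4)}
      ≤ ENNReal.ofReal (Real.exp (-N) + 2 / n) := by
  have hN' : (0 : ℝ) < N := by exact_mod_cast hN
  have hn' : (2 : ℝ) ≤ n := by exact_mod_cast hn
  have hlog : 0 ≤ Real.log n := Real.log_nonneg (by linarith)
  set V := 8 * σε ^ 2 * N with hV
  set u := N * (8 * σ * (σε * √(Real.log n / N))) with hu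
  have hu0 : 0 ≤ u := by positivity
  have hexp : -u ^ 2 / (2 * (σ ^ 2 * V)) = -4 * Real.log n := by
    have hs : √(Real.log n / N) ^ 2 = Real.log n / N := Real.sq_sqrt (by positivity)
    have : u ^ 2 = 64 * N * σ ^ 2 * σε ^ 2 * Real.log n := by
      rw [hu]
      calc _ = N ^ 2 * (64 * σ ^ 2 * (σε ^ 2 * √(Real.log n / N) ^ 2)) := by ring
        _ = _ := by rw [hs]; field_simp
    rw [this, hV]
    field_simp
    ring
  have hsub : {ω | ¬ ∀ j, |∑ i, X ω i j * ε ω i| ≤ N * (lam / 4)}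
      ⊆ {ω | V ≤ ∑ i, ε ω i ^ 2}
        ∪ ⋃ j, {ω | ∑ i, ε ω i ^ 2 ≤ V ∧ u < |∑ i, X ω i j * ε ω i|} := by
    intro ω hω
    rcases le_total V (∑ i, ε ω i ^ 2) with hle | hle
    · exact Or.inl hle
    · refine Or.inr ?_
      obtain ⟨j, hj⟩ := not_forall.1 hω
      refine Set.mem_iUnion.2 ⟨j, hle, lt_of_le_of_lt ?_ (not_le.1 hj)⟩
      rw [hu]
      gcongr
      linarith
  have h1 : P {ω | V ≤ ∑ i, ε ω i ^ 2} ≤ ENNReal.ofReal (Real.exp (-N)) := by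
    rw [ENNReal.le_ofReal_iff_toReal_le (measure_ne_top _ _) (Real.exp_nonneg _)]
    exact measure_sum_sq_ge_le hε.measurable hε.indep hσε fun i => (hε.subGaussian i).2
  have h2 : ∀ j, P {ω | ∑ i, ε ω i ^ 2 ≤ V ∧ u < |∑ i, X ω i j * ε ω i|}
      ≤ ENNReal.ofReal (2 * Real.exp (-4 * Real.log n)) := by
    intro j
    rw [← hexp]
    refine measure_abs_sum_mul_indep_gt_le (W := fun ω i => X ω i j)
      (measurable_pi_lambda _ fun i => h.measurable_entry i j) hε.measurable ?_ ?_
      (fun i => h.subgaussian_entry i j) hu0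
    · exact hXε.comp (φ := fun x i => x i j) (ψ := id) (by fun_prop) measurable_id
    · exact h.indep.comp (fun _ x => x j) fun _ => by fun_prop
  have h3 : (n : ℝ) * (2 * Real.exp (-4 * Real.log n)) ≤ 2 / n := by
    have he : Real.exp (Real.log n) = n := Real.exp_log (by linarith)
    have h4 : Real.exp (-4 * Real.log n) ≤ Real.exp (-(2 * Real.log n)) :=
      Real.exp_le_exp.2 (by linarith)
    have h5 : Real.exp (-(2 * Real.log n)) = 1 / (n : ℝ) ^ 2 := by
      rw [Real.exp_neg, two_mul, Real.exp_add, he, one_div, sq]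
    rw [h5] at h4
    calc _ ≤ (n : ℝ) * (2 * (1 / (n : ℝ) ^ 2)) := by gcongr
      _ = _ := by field_simp
  calc _ ≤ P {ω | V ≤ ∑ i, ε ω i ^ 2}
        + P (⋃ j, {ω | ∑ i, ε ω i ^ 2 ≤ V ∧ u < |∑ i, X ω i j * ε ω i|}) :=
        (measure_mono hsub).trans (measure_union_le _ _)
    _ ≤ ENNReal.ofReal (Real.exp (-N))
        + ∑ _j : Fin n, ENNReal.ofReal (2 * Real.exp (-4 * Real.log n)) := by
        gcongr
        exact (measure_iUnion_fintype_le _ _).trans (Finset.sum_le_sum fun j _ => h2 j)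
    _ = ENNReal.ofReal (Real.exp (-N) + n * (2 * Real.exp (-4 * Real.log n))) := by
        rw [ENNReal.ofReal_add (by positivity) (by positivity), Finset.sum_const,
          Finset.card_univ, Fintype.card_fin, nsmul_eq_mul,
          ENNReal.ofReal_mul (p := (n : ℝ)) (Nat.cast_nonneg n), ENNReal.ofReal_natCast]
    _ ≤ _ := ENNReal.ofReal_le_ofReal (by linarith)

end Noise

/-! ### From the cone inequality to the error bounds -/

/-- Real arithmetic in rescaled variables: w = τ‖v‖₁, Λ = λ/τ, α and b are τ times the cone
coefficients, and r is the rate. The cone bounds w² by θrD² plus a tail, and `hθK` lets c·w² take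
only a quarter of κD². A second quarter pays for the cross term in the prediction error, so half of
κD² survives. -/
lemma error_bounds_of_cone {κ c θ a K σ₀ C₁ σ Λ α b w D pred r : ℝ} (hκ : 0 < κ) (hc : 0 ≤ c)
    (hθ : 0 ≤ θ) (ha : 0 ≤ a) (hK : 0 ≤ K) (hσ₀ : 0 < σ₀) (hC₁ : 0 ≤ C₁)
    (hθK : 128 * c * θ * K ≤ κ) (hσ : σ₀ ≤ σ) (hΛ : 0 < Λ) (hΛC : Λ ≤ C₁ * σ)
    (hα2 : α ^ 2 ≤ 8 * θ * r) (hb : 0 ≤ b) (hbr : b ≤ a * r) (hr : 0 ≤ r)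
    (hrK : r ≤ K) (hw : 0 ≤ w) (hpred : 0 ≤ pred)
    (hcone : pred + 3 / 2 * (Λ * w) ≤ 2 * Λ * (α * D + 2 * b))
    (hRE : κ * D ^ 2 ≤ pred + c * w ^ 2) {M : ℝ}
    (hM : M = 16 * c * a ^ 2 * K / σ₀ ^ 2 + 32 * θ * C₁ ^ 2 / κ + 4 * C₁ * a / σ₀) :
    D ^ 2 ≤ 2 / κ * M * (σ ^ 2 * r) ∧ pred ≤ 2 * M * (σ ^ 2 * r) ∧
      w ^ 2 ≤ (64 * θ * M / κ + 16 * a ^ 2 / σ₀ ^ 2) * (σ ^ 2 * r ^ 2) := by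
  have hσ0 : 0 < σ := hσ₀.trans_le hσ
  have hw1 : w ≤ 4 / 3 * (α * D + 2 * b) := by
    have : Λ * w ≤ Λ * (4 / 3 * (α * D + 2 * b)) := by linarith
    exact le_of_mul_le_mul_left this hΛ
  have hw2 : w ^ 2 ≤ 32 * θ * r * D ^ 2 + 16 * a ^ 2 * r ^ 2 := by
    have h1 : w ^ 2 ≤ (4 / 3 * (α * D + 2 * b)) ^ 2 := pow_le_pow_left₀ hw hw1 2
    have h2 : (4 / 3 * (α * D + 2 * b)) ^ 2 ≤ 4 * (α ^ 2 * D ^ 2) + 16 * b ^ 2 := by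
      nlinarith [sq_nonneg (α * D - 2 * b), sq_nonneg (α * D), sq_nonneg b]
    have h3 : α ^ 2 * D ^ 2 ≤ 8 * θ * r * D ^ 2 := by gcongr
    have h4 : b ^ 2 ≤ (a * r) ^ 2 := pow_le_pow_left₀ hb hbr 2
    linarith [mul_pow a r 2]
  -- The tail terms have degree 0 or 1 in σ; the lower bound σ₀ raises them to the required factor
  -- σ².
  have hs1 : 1 ≤ σ ^ 2 / σ₀ ^ 2 := by
    rw [one_le_div (by positivity)]; exact pow_le_pow_left₀ hσ₀.le hσ 2
  have hs2 : σ ≤ σ ^ 2 / σ₀ := by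
    rw [le_div_iff₀ hσ₀, sq]; gcongr
  have hcw : c * w ^ 2 ≤ κ / 4 * D ^ 2 + 16 * c * a ^ 2 * K / σ₀ ^ 2 * (σ ^ 2 * r) := by
    have h1 : c * w ^ 2 ≤ c * (32 * θ * r * D ^ 2 + 16 * a ^ 2 * r ^ 2) := by gcongr
    have h2 : c * (32 * θ * r * D ^ 2) ≤ κ / 4 * D ^ 2 := by
      have : c * θ * r ≤ c * θ * K := by gcongr
      calc c * (32 * θ * r * D ^ 2) = 32 * (c * θ * r) * D ^ 2 := by ring
        _ ≤ κ / 4 * D ^ 2 := by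
          gcongr
          linarith
    have h3 : c * (16 * a ^ 2 * r ^ 2) ≤ 16 * c * a ^ 2 * K / σ₀ ^ 2 * (σ ^ 2 * r) := by
      calc c * (16 * a ^ 2 * r ^ 2) = 16 * c * a ^ 2 * r * r * 1 := by ring
        _ ≤ 16 * c * a ^ 2 * K * r * (σ ^ 2 / σ₀ ^ 2) := by gcongr
        _ = _ := by ring
    linarith
  have hp : pred ≤ κ / 4 * D ^ 2 + (32 * θ * C₁ ^ 2 / κ + 4 * C₁ * a / σ₀) * (σ ^ 2 * r) := by
    have h1 : pred ≤ 2 * (Λ * α) * D + 4 * (Λ * b) := by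
      nlinarith [mul_nonneg hΛ.le hw]
    have h2 : 2 * (Λ * α) * D ≤ κ / 4 * D ^ 2 + 4 / κ * (Λ * α) ^ 2 := by
      have h : κ / 4 * D ^ 2 + 4 / κ * (Λ * α) ^ 2 - 2 * (Λ * α) * D
          = (κ * D - 4 * (Λ * α)) ^ 2 / (4 * κ) := by
        field_simp; ring
      have : 0 ≤ (κ * D - 4 * (Λ * α)) ^ 2 / (4 * κ) := by positivity
      linarith
    have h3 : 4 / κ * (Λ * α) ^ 2 ≤ 32 * θ * C₁ ^ 2 / κ * (σ ^ 2 * r) := by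
      calc 4 / κ * (Λ * α) ^ 2 = 4 / κ * (Λ ^ 2 * α ^ 2) := by ring
        _ ≤ 4 / κ * ((C₁ * σ) ^ 2 * (8 * θ * r)) := by gcongr
        _ = _ := by ring
    have h4 : 4 * (Λ * b) ≤ 4 * C₁ * a / σ₀ * (σ ^ 2 * r) := by
      calc 4 * (Λ * b) ≤ 4 * (C₁ * σ * (a * r)) := by gcongr
        _ = 4 * C₁ * a * r * σ := by ring
        _ ≤ 4 * C₁ * a * r * (σ ^ 2 / σ₀) := by gcongr
        _ = _ := by ring
    linarith
  have hMsum : M * (σ ^ 2 * r) = 16 * c * a ^ 2 * K / σ₀ ^ 2 * (σ ^ 2 * r)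
      + (32 * θ * C₁ ^ 2 / κ + 4 * C₁ * a / σ₀) * (σ ^ 2 * r) := by rw [hM]; ring
  have hcpos : 0 ≤ 16 * c * a ^ 2 * K / σ₀ ^ 2 * (σ ^ 2 * r) := by positivity
  have hM0 : 0 ≤ M := by rw [hM]; positivity
  have hκD : κ / 2 * D ^ 2 ≤ M * (σ ^ 2 * r) := by linarith
  have hD : D ^ 2 ≤ 2 / κ * M * (σ ^ 2 * r) := by
    calc D ^ 2 = 2 / κ * (κ / 2 * D ^ 2) := by field_simp
      _ ≤ 2 / κ * (M * (σ ^ 2 * r)) := by gcongr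
      _ = _ := by ring
  refine ⟨hD, by linarith, ?_⟩
  calc w ^ 2 ≤ 32 * θ * r * D ^ 2 + 16 * a ^ 2 * r ^ 2 * 1 := by linarith
    _ ≤ 32 * θ * r * (2 / κ * M * (σ ^ 2 * r)) + 16 * a ^ 2 * r ^ 2 * (σ ^ 2 / σ₀ ^ 2) := by gcongr
    _ = _ := by ring

lemma exists_rpow_neg_le {q₁ q₂ θ : ℝ} (hq₁ : 0 < q₁) (hq₂ : 0 < q₂) (hθ : 0 < θ) :
    ∃ a : ℝ, 1 ≤ a ∧ a ^ (-q₁) ≤ θ ∧ a ^ (-q₂) ≤ θ :=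
  ((eventually_ge_atTop 1).and
    (((tendsto_rpow_neg_atTop hq₁).eventually (eventually_le_nhds hθ)).and
      ((tendsto_rpow_neg_atTop hq₂).eventually (eventually_le_nhds hθ)))).exists

/-- At threshold aτ the squared penalty cost of the active set has the order of the rate, with the
factor a^(-q) that can be made small. -/
lemma sq_mul_rpow_neg_le {a τ q θ : ℝ} (ha : 1 ≤ a) (hτ : 0 < τ) (hθ : a ^ (-q) ≤ θ) :
    τ ^ 2 * (a * τ) ^ (-q) ≤ θ * (τ ^ 2) ^ (1 - q / 2) := by
  have h1 : (τ ^ 2) ^ (1 - q / 2) = τ ^ 2 * τ ^ (-q) := by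
    rw [← Real.rpow_natCast, ← Real.rpow_mul hτ.le, ← Real.rpow_add hτ]
    congr 1; push_cast; ring
  rw [Real.mul_rpow (by linarith) hτ.le, h1]
  calc _ = a ^ (-q) * (τ ^ 2 * τ ^ (-q)) := by ring
    _ ≤ _ := by gcongr

/-- The companion for the ℓ₁ tail: the same order, but with a factor growing with a. -/
lemma mul_rpow_one_sub_le {a τ q : ℝ} (ha : 1 ≤ a) (hτ : 0 < τ) (hq : 0 < q) :
    τ * (a * τ) ^ (1 - q) ≤ a * (τ ^ 2) ^ (1 - q / 2) := by
  have h1 : (τ ^ 2) ^ (1 - q / 2) = τ * τ ^ (1 - q) := by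
    rw [← Real.rpow_natCast, ← Real.rpow_mul hτ.le]
    nth_rewrite 2 [← Real.rpow_one τ]
    rw [← Real.rpow_add hτ]
    congr 1; push_cast; ring
  have h2 : a ^ (1 - q) ≤ a := by
    conv_rhs => rw [← Real.rpow_one a]
    exact Real.rpow_le_rpow_of_exponent_le ha (by linarith)
  rw [Real.mul_rpow (by linarith) hτ.le, h1]
  calc _ = a ^ (1 - q) * (τ * τ ^ (1 - q)) := by ring
    _ ≤ _ := by gcongr

theorem exists_error_constant {σx c : ℝ} (hσx : 0 < σx) (hc : 0 < c) (k : ℕ) {q₁ q₂ : ℝ}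
    (hq₁ : 0 < q₁) (hq₁' : q₁ < 1) (hq₂ : 0 < q₂) (hq₂' : q₂ < 1) (C₁ K : ℝ) {σ₀ : ℝ}
    (hσ₀ : 0 < σ₀) :
    ∃ M : ℝ, 0 < M ∧ ∀ (N n : ℕ) (σε R₁ R₂ lam : ℝ) (G : SimpleGraph (Fin n))
      (X : Matrix (Fin N) (Fin n) ℝ) (ε : Fin N → ℝ) (βs b : Fin n → ℝ),
      0 < N → 2 ≤ n → σ₀ ≤ σε → 0 < R₁ → 0 < R₂ →
      R₁ * (Real.log n / N) ^ (1 - q₁ / 2) + R₂ * (Real.log n / N) ^ (1 - q₂ / 2) ≤ K →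
      βs ∈ weakSpace G k q₁ q₂ R₁ R₂ →
      32 * σx * (σε * √(Real.log n / N)) ≤ lam → lam ≤ C₁ * (σε * √(Real.log n / N)) →
      IsGPPLasso G k (penaltyRatio k (maxDeg G) * lam) lam X (X.mulVec βs + ε) b →
      (∀ j, |∑ i, X i j * ε i| ≤ N * (lam / 4)) →
      (∀ v : Fin n → ℝ, c / 2 * ∑ j, v j ^ 2 ≤ 1 / (N : ℝ) * ∑ l, X.mulVec v l ^ 2
          + reTol σx c * (Real.log n / N) * (∑ j, |v j|) ^ 2) →
      ∑ j, (b j - βs j) ^ 2 ≤ M * (σε ^ 2 * (R₁ * (Real.log n / N) ^ (1 - q₁ / 2)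
          + R₂ * (Real.log n / N) ^ (1 - q₂ / 2))) ∧
      1 / (N : ℝ) * ∑ i, X.mulVec (b - βs) i ^ 2
        ≤ M * (σε ^ 2 * (R₁ * (Real.log n / N) ^ (1 - q₁ / 2)
          + R₂ * (Real.log n / N) ^ (1 - q₂ / 2))) ∧
      (∑ j, |b j - βs j|) ^ 2 ≤ M * (σε ^ 2 * (R₁ ^ 2 * (Real.log n / N) ^ (1 - q₁)
          + R₂ ^ 2 * (Real.log n / N) ^ (1 - q₂))) := by
  have hT := reTol_pos hσx hc
  set T := reTol σx c with hTdef
  -- Chosen for equality in the absorption condition; |K| + 1 is positive whatever the sign of `K`.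
  set θ := c / 2 / (128 * T * (|K| + 1)) with hθdef
  have hK0 : 0 < |K| + 1 := by positivity
  have hθ : 0 < θ := by positivity
  obtain ⟨a, ha1, haq₁, haq₂⟩ := exists_rpow_neg_le hq₁ hq₂ hθ
  have ha0 : 0 < a := by linarith
  set M₀ := 16 * T * a ^ 2 * (|K| + 1) / σ₀ ^ 2 + 32 * θ * |C₁| ^ 2 / (c / 2)
    + 4 * |C₁| * a / σ₀ with hM₀
  have hM₀pos : 0 < M₀ := by positivity
  set M₁ := 64 * θ * M₀ / (c / 2) + 16 * a ^ 2 / σ₀ ^ 2 with hM₁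
  have hM₁pos : 0 < M₁ := by positivity
  refine ⟨2 / (c / 2) * M₀ + 2 * M₀ + 2 * M₁, by positivity, ?_⟩
  intro N n σε R₁ R₂ lam G X ε βs b hN hn hσε hR₁ hR₂ hrK hβ hlam hlam' hb hnoise hRE
  have hN' : (0 : ℝ) < N := by exact_mod_cast hN
  have hn' : (2 : ℝ) ≤ n := by exact_mod_cast hn
  have hlog : 0 < Real.log n := Real.log_pos (by linarith)
  have hσε0 : 0 < σε := hσ₀.trans_le hσε
  set τ := √(Real.log n / N) with hτdef
  have hρ : 0 < Real.log n / N := by positivity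
  have hτ : 0 < τ := Real.sqrt_pos.2 hρ
  have hτ2 : Real.log n / N = τ ^ 2 := (Real.sq_sqrt hρ.le).symm
  rw [hτ2] at hrK hRE ⊢
  have hlam0 : 0 < lam := lt_of_lt_of_le (by positivity) hlam
  obtain ⟨A, hA0, hA2, hcone⟩ := hb.cone_inequality hlam0.le hN hnoise hq₁ hq₁' hq₂ hq₂'
    (mul_pos ha0 hτ) hβ
  set r := R₁ * (τ ^ 2) ^ (1 - q₁ / 2) + R₂ * (τ ^ 2) ^ (1 - q₂ / 2) with hr
  have hr0 : 0 ≤ r := by positivity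
  set B := R₁ * (a * τ) ^ (1 - q₁) + R₂ * (a * τ) ^ (1 - q₂) with hB
  set L := ∑ j, |b j - βs j| with hL
  have hL0 : 0 ≤ L := Finset.sum_nonneg fun _ _ => abs_nonneg _
  set D := √(∑ j, (b j - βs j) ^ 2) with hD
  have hD2 : D ^ 2 = ∑ j, (b j - βs j) ^ 2 :=
    Real.sq_sqrt (Finset.sum_nonneg fun _ _ => sq_nonneg _)
  set pred := 1 / (N : ℝ) * ∑ i, X.mulVec (b - βs) i ^ 2 with hpred
  have hpred0 : 0 ≤ pred := by positivity
  have hα : (τ * A) ^ 2 ≤ 8 * θ * r := by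
    calc (τ * A) ^ 2 = τ ^ 2 * A ^ 2 := mul_pow _ _ _
      _ ≤ τ ^ 2 * (8 * (R₁ * (a * τ) ^ (-q₁) + R₂ * (a * τ) ^ (-q₂))) := by gcongr
      _ = 8 * (R₁ * (τ ^ 2 * (a * τ) ^ (-q₁)) + R₂ * (τ ^ 2 * (a * τ) ^ (-q₂))) := by ring
      _ ≤ 8 * (R₁ * (θ * (τ ^ 2) ^ (1 - q₁ / 2)) + R₂ * (θ * (τ ^ 2) ^ (1 - q₂ / 2))) := by
          have h1 := mul_le_mul_of_nonneg_left (sq_mul_rpow_neg_le ha1 hτ haq₁) hR₁.le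
          have h2 := mul_le_mul_of_nonneg_left (sq_mul_rpow_neg_le ha1 hτ haq₂) hR₂.le
          linarith
      _ = _ := by rw [hr]; ring
  have hbr : τ * B ≤ a * r := by
    calc τ * B = R₁ * (τ * (a * τ) ^ (1 - q₁)) + R₂ * (τ * (a * τ) ^ (1 - q₂)) := by
          rw [hB]; ring
      _ ≤ R₁ * (a * (τ ^ 2) ^ (1 - q₁ / 2)) + R₂ * (a * (τ ^ 2) ^ (1 - q₂ / 2)) := by
          have h1 := mul_le_mul_of_nonneg_left (mul_rpow_one_sub_le ha1 hτ hq₁) hR₁.le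
          have h2 := mul_le_mul_of_nonneg_left (mul_rpow_one_sub_le ha1 hτ hq₂) hR₂.le
          linarith
      _ = _ := by rw [hr]; ring
  have hΛC : lam / τ ≤ |C₁| * σε := by
    rw [div_le_iff₀ hτ]
    calc lam ≤ C₁ * (σε * τ) := hlam'
      _ ≤ |C₁| * (σε * τ) := by gcongr; exact le_abs_self _
      _ = _ := by ring
  have hcone' : pred + 3 / 2 * (lam / τ * (τ * L))
      ≤ 2 * (lam / τ) * (τ * A * D + 2 * (τ * B)) := by
    calc _ = pred + 3 / 2 * (lam * L) := by field_simp
      _ ≤ 2 * lam * (A * D + 2 * B) := hcone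
      _ = _ := by field_simp
  have hRE' : c / 2 * D ^ 2 ≤ pred + T * (τ * L) ^ 2 := by
    have := hRE (b - βs)
    simp only [Pi.sub_apply] at this
    rw [hD2]
    refine this.trans (le_of_eq ?_)
    ring
  obtain ⟨e1, e2, e3⟩ := error_bounds_of_cone (half_pos hc) hT.le hθ.le ha0.le hK0.le hσ₀
    (abs_nonneg C₁) (le_of_eq (by rw [hθdef]; field_simp)) hσε (div_pos hlam0 hτ) hΛC hα
    (by positivity) hbr hr0 (hrK.trans ((le_abs_self K).trans (by linarith)))
    (mul_nonneg hτ.le hL0) hpred0 hcone' hRE' hM₀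
  rw [← hM₁] at e3
  have hσr : 0 ≤ σε ^ 2 * r := by positivity
  have hM1r : 0 ≤ M₁ * (σε ^ 2 * r) := by positivity
  have hM0r : 0 ≤ M₀ * (σε ^ 2 * r) := by positivity
  have hM0r' : 0 ≤ 2 / (c / 2) * M₀ * (σε ^ 2 * r) := by positivity
  refine ⟨?_, ?_, ?_⟩
  · rw [← hD2]; linarith
  · linarith
  -- The ℓ₁ bound is for τ‖v‖₁, so a factor τ² must be cancelled. It is found in r², since
  -- (τ²)^(2-q) = τ²(τ²)^(1-q); squaring the two-term sum costs the 2 in front of M₁.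
  · have hq : ∀ q : ℝ, ((τ ^ 2) ^ (1 - q / 2)) ^ 2 = τ ^ 2 * (τ ^ 2) ^ (1 - q) := by
      intro q
      have hp : (0 : ℝ) < τ ^ 2 := by positivity
      rw [← Real.rpow_natCast, ← Real.rpow_mul hp.le]
      have h1 : τ ^ 2 * (τ ^ 2) ^ (1 - q) = (τ ^ 2) ^ (1 + (1 - q)) := by
        rw [Real.rpow_add hp, Real.rpow_one]
      rw [h1]
      congr 1; push_cast; ring
    set r' := R₁ ^ 2 * (τ ^ 2) ^ (1 - q₁) + R₂ ^ 2 * (τ ^ 2) ^ (1 - q₂) with hr'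
    have hr2 : r ^ 2 ≤ 2 * (τ ^ 2 * r') := by
      calc r ^ 2 ≤ 2 * ((R₁ * (τ ^ 2) ^ (1 - q₁ / 2)) ^ 2
            + (R₂ * (τ ^ 2) ^ (1 - q₂ / 2)) ^ 2) := add_sq_le
        _ = _ := by rw [mul_pow, mul_pow, hq, hq, hr']; ring
    have h1 : τ ^ 2 * L ^ 2 ≤ τ ^ 2 * (2 * M₁ * (σε ^ 2 * r')) := by
      calc τ ^ 2 * L ^ 2 = (τ * L) ^ 2 := by ring
        _ ≤ M₁ * (σε ^ 2 * r ^ 2) := e3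
        _ ≤ M₁ * (σε ^ 2 * (2 * (τ ^ 2 * r'))) := by gcongr
        _ = _ := by ring
    have h2 := le_of_mul_le_mul_left h1 (by positivity)
    have hr'0 : 0 ≤ r' := by positivity
    have h3 : 0 ≤ (2 / (c / 2) * M₀ + 2 * M₀) * (σε ^ 2 * r') := by positivity
    linarith

/-! ### From good events to stochastic orders -/

/-- Only monotonicity and subadditivity of the measure are used, so the estimator need not be
measurable. -/
lemma measure_compl_le_of_imp {Ω : Type*} [MeasurableSpace Ω] {P : Measure Ω}
    {A B : Ω → Prop} {Y : Ω → ℝ} {M a δ : ℝ} (hM : 0 < M) (hY : ∀ ω, 0 ≤ Y ω)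
    (h : ∀ ω, A ω → B ω → Y ω ≤ M * a)
    (hAB : P {ω | ¬ A ω} + P {ω | ¬ B ω} ≤ ENNReal.ofReal δ) :
    P {ω | M * |a| < |Y ω|} ≤ ENNReal.ofReal δ := by
  refine le_trans (measure_mono fun ω hω => ?_) ((measure_union_le _ _).trans hAB)
  by_contra hcon
  simp only [Set.mem_union, Set.mem_ofPred_eq, not_or, not_not] at hcon
  have h1 := h ω hcon.1 hcon.2
  have h2 : M * |a| < |Y ω| := hω
  rw [abs_of_nonneg (hY ω)] at h2
  have h3 : M * a ≤ M * |a| := by gcongr; exact le_abs_self a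
  linarith

end GraphLasso

theorem theorem4
    -- sub-Gaussian parameter of the design
    (σx : ℝ) (hσx : 0 < σx)
    -- dimension-free eigenvalue bounds
    (cl cu : ℝ) (hcl : 0 < cl) :
    ∃ C₀ : ℝ, 0 < C₀ ∧
      ∀ (k : ℕ) (q₁ q₂ : ℝ), 0 < q₁ → q₁ < 1 → 0 < q₂ → q₂ < 1 →
      ∀ (C₁ K σ₀ : ℝ), 0 < σ₀ →
      -- a sequence of problems with `N` observations, `n` nodes and noise level `σε`
      ∀ (N n : ℕ → ℕ), Tendsto N atTop atTop → Tendsto n atTop atTop →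
      ∀ (σε : ℕ → ℝ), (∀ t, σ₀ ≤ σε t) →
      ∀ (R₁ R₂ : ℕ → ℝ), (∀ t, 0 < R₁ t) → (∀ t, 0 < R₂ t) →
      (∀ t, R₁ t * (Real.log (n t) / N t) ^ (1 - q₁ / 2)
          + R₂ t * (Real.log (n t) / N t) ^ (1 - q₂ / 2) ≤ K) →
      ∀ (G : ∀ t, SimpleGraph (Fin (n t))) (βstar : ∀ t, Fin (n t) → ℝ),
      (∀ t, βstar t ∈ GraphLasso.weakSpace (G t) k q₁ q₂ (R₁ t) (R₂ t)) →
      ∀ (lam lamg : ℕ → ℝ),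
      (∀ t, C₀ * (σε t * Real.sqrt (Real.log (n t) / N t)) ≤ lam t ∧
          lam t ≤ C₁ * (σε t * Real.sqrt (Real.log (n t) / N t))) →
      (∀ t, lamg t = (2 : ℝ) ^ (-(1 + (k : ℝ) / 2))
          * (GraphLasso.maxDeg (G t) : ℝ) ^ (-(((k : ℝ) + 1) / 2)) * lam t) →
      ∀ (Ω : ℕ → Type*) [∀ t, MeasurableSpace (Ω t)] (P : ∀ t, Measure (Ω t))
        [∀ t, IsProbabilityMeasure (P t)]
        (S : ∀ t, Matrix (Fin (n t)) (Fin (n t)) ℝ)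
        (X : ∀ t, Ω t → Fin (N t) → Fin (n t) → ℝ) (ε : ∀ t, Ω t → Fin (N t) → ℝ)
        (y : ∀ t, Ω t → Fin (N t) → ℝ) (βhat : ∀ t, Ω t → Fin (n t) → ℝ),
      (∀ t, GraphLasso.IsRowwiseSubGaussian (P t) (X t) σx (S t)) →
      (∀ t, ∀ μ ∈ spectrum ℝ (S t), cl ≤ μ ∧ μ ≤ cu) →
      (∀ t, GraphLasso.IsSubGaussianNoise (P t) (ε t) (σε t)) →
      (∀ t, IndepFun (X t) (ε t) (P t)) →
      (∀ t ω, y t ω = (Matrix.of (X t ω)).mulVec (βstar t) + ε t ω) →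
      (∀ t ω, GraphLasso.IsGPPLasso (G t) k (lamg t) (lam t)
          (Matrix.of (X t ω)) (y t ω) (βhat t ω)) →
      -- squared `ℓ₂` error
      GraphLasso.IsBigOP P (fun t ω => ∑ j, (βhat t ω j - βstar t j) ^ 2)
        (fun t => σε t ^ 2 * (R₁ t * (Real.log (n t) / N t) ^ (1 - q₁ / 2)
          + R₂ t * (Real.log (n t) / N t) ^ (1 - q₂ / 2))) ∧
      -- prediction error
      GraphLasso.IsBigOP P
        (fun t ω => 1 / (N t : ℝ) *
          ∑ i, ((Matrix.of (X t ω)).mulVec (βhat t ω - βstar t) i) ^ 2)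
        (fun t => σε t ^ 2 * (R₁ t * (Real.log (n t) / N t) ^ (1 - q₁ / 2)
          + R₂ t * (Real.log (n t) / N t) ^ (1 - q₂ / 2))) ∧
      -- squared `ℓ₁` error
      GraphLasso.IsBigOP P (fun t ω => (∑ j, |βhat t ω j - βstar t j|) ^ 2)
        (fun t => σε t ^ 2 * (R₁ t ^ 2 * (Real.log (n t) / N t) ^ (1 - q₁)
          + R₂ t ^ 2 * (Real.log (n t) / N t) ^ (1 - q₂))) := by
  refine ⟨32 * σx, by positivity, ?_⟩
  intro k q₁ q₂ hq₁ hq₁' hq₂ hq₂' C₁ K σ₀ hσ₀ N n hN hn σε hσε R₁ R₂ hR₁ hR₂ hK G βstar hβ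
    lam lamg hlam hlamg Ω _ P _ S X ε y βhat hX hS hε hXε hy hβhat
  obtain ⟨M, hM, hmain⟩ := GraphLasso.exists_error_constant hσx hcl k hq₁ hq₁' hq₂ hq₂' C₁ K hσ₀
  have hr := GraphLasso.reRate_pos hσx hcl
  set r := GraphLasso.reRate σx cl with hrdef
  have hNR : Tendsto (fun t => (N t : ℝ)) atTop atTop := tendsto_natCast_atTop_atTop.comp hN
  have hnR : Tendsto (fun t => (n t : ℝ)) atTop atTop := tendsto_natCast_atTop_atTop.comp hn
  have hlim : Tendsto (fun t => Real.exp (-(N t : ℝ)) + 2 / (n t : ℝ)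
      + 2 * Real.exp (-(r * N t))) atTop (nhds 0) := by
    have h1 := Real.tendsto_exp_neg_atTop_nhds_zero.comp hNR
    have h2 := hnR.const_div_atTop (2 : ℝ)
    have h3 := (Real.tendsto_exp_neg_atTop_nhds_zero.comp (hNR.const_mul_atTop hr)).const_mul 2
    simpa using (h1.add h2).add h3
  -- Both good events serve all three claims, and the constant `M` does not depend on δ: a smaller δ
  -- only moves the starting index.
  have hgood : ∀ δ : ℝ, 0 < δ → ∀ᶠ t in atTop, 0 < N t ∧ 2 ≤ n t ∧
      P t {ω | ¬ ∀ j, |∑ i, X t ω i j * ε t ω i| ≤ N t * (lam t / 4)}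
        + P t {ω | ¬ ∀ v : Fin (n t) → ℝ, cl / 2 * ∑ j, v j ^ 2
          ≤ 1 / (N t : ℝ) * ∑ l, (Matrix.of (X t ω)).mulVec v l ^ 2
            + GraphLasso.reTol σx cl * (Real.log (n t) / N t) * (∑ j, |v j|) ^ 2}
        ≤ ENNReal.ofReal δ := by
    intro δ hδ
    filter_upwards [hN.eventually_gt_atTop 0, hn.eventually_ge_atTop 2,
      hlim.eventually (eventually_le_nhds hδ)] with t ht1 ht2 ht3
    refine ⟨ht1, ht2, ?_⟩
    have h1 := (hX t).measure_noise_gt_le (hε t) (hXε t) ht1 ht2 hσx (hσ₀.trans_le (hσε t))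
      (hlam t).1
    have h2 := (hX t).measure_not_restricted_eigenvalue_le ht1 ht2 hσx hcl
      fun μ hμ => (hS t μ hμ).1
    have h3 := (ENNReal.le_ofReal_iff_toReal_le (measure_ne_top _ _) (by positivity)).2 h2
    refine (add_le_add h1 h3).trans ?_
    rw [← ENNReal.ofReal_add (by positivity) (by positivity)]
    exact ENNReal.ofReal_le_ofReal ht3
  have hlasso : ∀ t ω, GraphLasso.IsGPPLasso (G t) k
      (GraphLasso.penaltyRatio k (GraphLasso.maxDeg (G t)) * lam t) (lam t)
      (Matrix.of (X t ω)) ((Matrix.of (X t ω)).mulVec (βstar t) + ε t ω) (βhat t ω) := by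
    intro t ω
    rw [← hy t ω]
    have := hβhat t ω
    rwa [hlamg t] at this
  refine ⟨fun δ hδ => ⟨M, hM, ?_⟩, fun δ hδ => ⟨M, hM, ?_⟩, fun δ hδ => ⟨M, hM, ?_⟩⟩
  · filter_upwards [hgood δ hδ] with t ht
    exact GraphLasso.measure_compl_le_of_imp hM
      (fun ω => Finset.sum_nonneg fun _ _ => sq_nonneg _)
      (fun ω hA hB => (hmain _ _ _ _ _ _ _ _ _ _ _ ht.1 ht.2.1 (hσε t) (hR₁ t) (hR₂ t) (hK t)
        (hβ t) (hlam t).1 (hlam t).2 (hlasso t ω) hA hB).1) ht.2.2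
  · filter_upwards [hgood δ hδ] with t ht
    exact GraphLasso.measure_compl_le_of_imp hM
      (fun ω => by positivity)
      (fun ω hA hB => (hmain _ _ _ _ _ _ _ _ _ _ _ ht.1 ht.2.1 (hσε t) (hR₁ t) (hR₂ t) (hK t)
        (hβ t) (hlam t).1 (hlam t).2 (hlasso t ω) hA hB).2.1) ht.2.2
  · filter_upwards [hgood δ hδ] with t ht
    exact GraphLasso.measure_compl_le_of_imp hM
      (fun ω => sq_nonneg _)
      (fun ω hA hB => (hmain _ _ _ _ _ _ _ _ _ _ _ ht.1 ht.2.1 (hσε t) (hR₁ t) (hR₂ t) (hK t)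
        (hβ t) (hlam t).1 (hlam t).2 (hlasso t ω) hA hB).2.2) ht.2.2
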